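/- Let $(A,\mathfrak m)$ be a one-dimensional Cohen–Macaulay local ring with infinite residue field, let $xA$ be a minimal reduction of $\mathfrak m$, and let $r$ be the reduction number of $A$, i.e. the least integer with $\mathfrak m^{r+1}=x\mathfrak m^r$. Write $\lambda$ for the length of an $A$-module and $(I:x^k)=\{a\in A: ax^k\in I\}$ (so $(\mathfrak m^r:x^{-1})=x\mathfrak m^r$). Consider: - the graded rings $F(x)=\bigoplus_{n\ge 0}x^nA/x^n\mathfrak m$ and $G(\mathfrak m)=\bigoplus_{n\ge0}\mathfrak m^n/\mathfrak m^{n+1}$, the class $x^*\in F(x)_1$ of $x$, and the invariants $\alpha_i,\alpha_{i,j}$ of the tangent cone with respect to $x$, defined by an isomorphism of graded $F(x)$-modules $$G(\mathfrak m)\cong\bigoplus_{i=0}^{r}\bigl(F(x)(-i)\bigr)^{\alpha_i}\oplus\bigoplus_{i=1}^{r-1}\bigoplus_{j=1}^{r-i}\Bigl(\tfrac{F(x)}{(x^*)^jF(x)}(-i)\Bigr)^{\alpha_{i,j}};$$ - the first neighborhood ring $A'$ of $A$, i.e. the subring of the total ring of fractions of $A$ of all $b/a$ with $b\in\mathfrak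 m^s$ and $a\in\mathfrak m^s$ superficial of degree $s$ (that is, $\mathfrak m^{n+s}=a\mathfrak m^n$ for all large $n$), and the micro-invariants, for $1\le i\le r$, $$\beta_i=\lambda\Bigl(\frac{A+\mathfrak m^{i-1}A'}{A+\mathfrak m^{i}A'}\Bigr)-\lambda\Bigl(\frac{A+\mathfrak m^{i}A'}{A+\mathfrak m^{i+1}A'}\Bigr);$$ - the Apery invariants with respect to $x$, $$\gamma_i=\lambda\Bigl(\frac{\mathfrak m^i+xA}{\mathfrak m^{i+1}+xA}\Bigr);$$ - the lengths $$\nu_i=\lambda\Bigl(\frac{\mathfrak m^i\cap xA+\mathfrak m^{i+1}}{x\mathfrak m^{i-1}+\mathfrak m^{i+1}}\Bigr),\qquad g_i=\lambda\Bigl(\frac{(\mathfrak m^r:x^{r-i})}{\mathfrak m^i+(\mathfrak m^r:x^{r-i-1})}\Bigr).$$ Then such a decomposition of $G(\mathfrak m)$ exists, and for $1\le i\le r$ all the lengths occurring in $\beta_i,\gamma_i,\nu_i,g_i,g_{i-1}$ are finite, and for the numbers $\alpha_{i,j}$ of any such decomposition $$\beta_i+\sum_{j=1}^{r-i-1}\alpha_{i,j}=\gamma_i+\nu_i+g_i-g_{i-1}.$$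 -/

import Mathlib

namespace TangentCone

open IsLocalRing

/-- A Noetherian local ring is Cohen-Macaulay when its maximal ideal contains a regular sequence
whose length is the Krull dimension of the ring. -/
def IsCohenMacaulayLocal (A : Type*) [CommRing A] [IsLocalRing A] : Prop :=
  IsNoetherianRing A ∧
    ∃ rs : List A, (∀ a ∈ rs, a ∈ maximalIdeal A) ∧ RingTheory.Sequence.IsRegular A rs ∧
      ((rs.length : ℕ∞) : WithBot ℕ∞) = ringKrullDim A

section Reductions

variable {A : Type*} [CommRing A]

/-- `J` is a reduction of `I`. -/
def IsReduction (J I : Ideal A) : Prop :=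
  J ≤ I ∧ ∃ n : ℕ, I ^ (n + 1) = J * I ^ n

/-- `J` is a minimal reduction of `I`: a reduction containing no smaller reduction. -/
def IsMinimalReduction (J I : Ideal A) : Prop :=
  Minimal (fun J' : Ideal A => IsReduction J' I) J

/-- The reduction number of `I` with respect to a reduction `J`: the least `n` such that
`I ^ (n + 1) = J * I ^ n`. -/
noncomputable def reductionNumber (J I : Ideal A) : ℕ :=
  sInf {n : ℕ | I ^ (n + 1) = J * I ^ n}

end Reductions

/-- The length `λ(P / N)` of the quotient of two submodules `N ≤ P`. -/
noncomputable def quotLength {A M : Type*} [CommRing A] [AddCommGroup M] [Module A M]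
    (P N : Submodule A M) : ℕ∞ :=
  Module.length A (↥P ⧸ N.submoduleOf P)

/-- An inclusion of ideals induces an inclusion of Rees algebras. -/
theorem reesAlgebra_le {A : Type*} [CommRing A] {I J : Ideal A} (h : I ≤ J) : reesAlgebra I ≤ reesAlgebra J :=
  fun _ hf i => Ideal.pow_right_mono h i (hf i)

variable {A : Type*} [CommRing A] [IsLocalRing A]

/-! The tangent cone as a graded module over the Noether normalization -/

/-- The fiber cone `⨁ Iⁿ / 𝔪 Iⁿ` of an ideal `I`, as the quotient of the Rees algebra `⨁ Iⁿ Tⁿ` by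
the ideal generated by `𝔪`. For `I = 𝔪` this is the tangent cone `G(𝔪) = ⨁ 𝔪ⁿ / 𝔪ⁿ⁺¹`; for
`I = xA` it is the ring `F(x) = ⨁ xⁿA / xⁿ𝔪`. -/
def FiberCone (I : Ideal A) : Type _ :=
  ↥(reesAlgebra I) ⧸ (maximalIdeal A).map (algebraMap A ↥(reesAlgebra I))

noncomputable instance (I : Ideal A) : CommRing (FiberCone I) :=
  inferInstanceAs (CommRing (↥(reesAlgebra I) ⧸ (maximalIdeal A).map (algebraMap A ↥(reesAlgebra I))))

/-- The quotient map from the Rees algebra to the fiber cone. -/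
noncomputable def FiberCone.mk (I : Ideal A) : ↥(reesAlgebra I) →+* FiberCone I :=
  Ideal.Quotient.mk ((maximalIdeal A).map (algebraMap A ↥(reesAlgebra I)))

/-- The homogeneous component of degree `n` of the fiber cone: the classes of the elements `a Tⁿ`
with `a ∈ Iⁿ`. -/
def FiberCone.component (I : Ideal A) (n : ℕ) : Set (FiberCone I) :=
  {z | ∃ (a : A) (ha : a ∈ I ^ n),
    z = FiberCone.mk I (⟨Polynomial.monomial n a, reesAlgebra.monomial_mem.2 ha⟩ :
      ↥(reesAlgebra I))}

/-- The ring homomorphism `⨁ Iⁿ / 𝔪 Iⁿ → ⨁ Jⁿ / 𝔪 Jⁿ` induced by an inclusion `I ≤ J`. -/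
noncomputable def FiberCone.map {I J : Ideal A} (h : I ≤ J) : FiberCone I →+* FiberCone J :=
  Ideal.quotientMap _ (Subalgebra.inclusion (reesAlgebra_le h)).toRingHom <| by
    rw [Ideal.map_le_iff_le_comap]
    intro a ha
    exact Ideal.mem_map_of_mem (algebraMap A ↥(reesAlgebra J)) ha

/-- The class `x*` of `x` in the degree one component of `F(x)`. -/
noncomputable def xStar (x : A) : FiberCone (Ideal.span {x}) :=
  FiberCone.mk _ (⟨Polynomial.monomial 1 x,
    reesAlgebra.monomial_mem.2 (by rw [pow_one]; exact Ideal.mem_span_singleton_self x)⟩ :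
      ↥(reesAlgebra (Ideal.span {x})))

/-- `v` lies in the homogeneous component of degree `n` of `F(x)(-i)`, that is, in the component of
degree `n - i` of `F(x)`, which is zero for `n < i`. -/
def InShift (x : A) (i n : ℕ) (v : FiberCone (Ideal.span {x})) : Prop :=
  (i ≤ n ∧ v ∈ FiberCone.component (Ideal.span {x}) (n - i)) ∨ v = 0

/-- `v` lies in the homogeneous component of degree `n` of `(F(x) / (x*)ʲ F(x))(-i)`. -/
def InShiftQuot (x : A) (j i n : ℕ)
    (v : FiberCone (Ideal.span {x}) ⧸ Ideal.span {xStar x ^ j}) : Prop :=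
  ∃ w, InShift x i n w ∧ Ideal.Quotient.mk _ w = v

/-- The free summands: `α i` copies for each `0 ≤ i ≤ r`. -/
abbrev FreeIndex (r : ℕ) (α : ℕ → ℕ) : Type :=
  Σ i : ↥(Finset.Icc 0 r), Fin (α i.1)

/-- The torsion summands: `τ i j` copies for each `1 ≤ i ≤ r - 1` and `1 ≤ j ≤ r - i`. -/
abbrev TorsionIndex (r : ℕ) (τ : ℕ → ℕ → ℕ) : Type :=
  Σ p : ↥((Finset.Icc 1 (r - 1)).sigma fun i => Finset.Icc 1 (r - i)), Fin (τ p.1.1 p.1.2)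

/-- The numbers `α i` (`0 ≤ i ≤ r`) and `τ i j` (`1 ≤ i ≤ r - 1`, `1 ≤ j ≤ r - i`), where
`r` is the reduction number of `𝔪` with respect to `xA`, are the invariants of the tangent cone
with respect to `x`: there is an isomorphism of graded `F(x)`-modules
`⨁ (F(x)(-i))^(α i) ⊕ ⨁ ((F(x) / (x*)ʲ F(x))(-i))^(τ i j) ≃ G(𝔪)`,
`F(x)` acting on `G(𝔪)` through the ring homomorphism `F(x) → G(𝔪)`.
The direct sums are finite, and written as products. -/
def IsTangentConeInvariants (x : A) (hx : Ideal.span {x} ≤ maximalIdeal A)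
    (α : ℕ → ℕ) (τ : ℕ → ℕ → ℕ) : Prop :=
  let r := reductionNumber (Ideal.span {x}) (maximalIdeal A)
  ∃ e : ((FreeIndex r α → FiberCone (Ideal.span {x})) ×
      ((t : TorsionIndex r τ) →
        FiberCone (Ideal.span {x}) ⧸ Ideal.span {xStar x ^ t.1.1.2})) ≃+
      FiberCone (maximalIdeal A),
    (∀ f v, e (f • v) = FiberCone.map hx f * e v) ∧
    ∀ (n : ℕ) v,
      ((∀ s : FreeIndex r α, InShift x s.1.1 n (v.1 s)) ∧
        (∀ t : TorsionIndex r τ, InShiftQuot x t.1.1.2 t.1.1.1 n (v.2 t))) ↔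
      e v ∈ FiberCone.component (maximalIdeal A) n

/-! The first neighborhood ring and the micro-invariants -/

/-- `a` is a superficial element of degree `s`. -/
def IsSuperficial (s : ℕ) (a : A) : Prop :=
  a ∈ maximalIdeal A ^ s ∧
    ∃ N : ℕ, ∀ n ≥ N, maximalIdeal A ^ (n + s) = Ideal.span {a} * maximalIdeal A ^ n

variable (A) in
/-- The first neighborhood ring `A'`: the elements `b / a` of the total ring of fractions of `A`
with `b ∈ 𝔪ˢ` and `a` a (regular) superficial element of degree `s`. -/
def firstNeighborhood : Subalgebra A (FractionRing A) where
  carrier := {z | ∃ (s : ℕ) (a b : A), IsSuperficial s a ∧ a ∈ nonZeroDivisors A ∧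
    b ∈ maximalIdeal A ^ s ∧ z * algebraMap A (FractionRing A) a = algebraMap A (FractionRing A) b}
  mul_mem' := by
    rintro z z' ⟨s, a, b, ⟨ha, N, hN⟩, har, hb, h⟩ ⟨s', a', b', ⟨ha', N', hN'⟩, har', hb', h'⟩
    refine ⟨s + s', a * a', b * b', ⟨pow_add (maximalIdeal A) s s' ▸ Ideal.mul_mem_mul ha ha',
      N + N', fun n hn => ?_⟩, mul_mem har har',
      pow_add (maximalIdeal A) s s' ▸ Ideal.mul_mem_mul hb hb', ?_⟩
    · rw [← add_assoc, hN' (n + s) (by omega), hN n (by omega), ← mul_assoc,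
        Ideal.span_singleton_mul_span_singleton, mul_comm a']
    · rw [map_mul, map_mul, ← h, ← h']; ring
  add_mem' := by
    rintro z z' ⟨s, a, b, ⟨ha, N, hN⟩, har, hb, h⟩ ⟨s', a', b', ⟨ha', N', hN'⟩, har', hb', h'⟩
    refine ⟨s + s', a * a', b * a' + a * b',
      ⟨pow_add (maximalIdeal A) s s' ▸ Ideal.mul_mem_mul ha ha',
      N + N', fun n hn => ?_⟩, mul_mem har har',
      pow_add (maximalIdeal A) s s' ▸ Ideal.add_mem _ (Ideal.mul_mem_mul hb ha')
        (Ideal.mul_mem_mul ha hb'), ?_⟩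
    · rw [← add_assoc, hN' (n + s) (by omega), hN n (by omega), ← mul_assoc,
        Ideal.span_singleton_mul_span_singleton, mul_comm a']
    · rw [map_mul, map_add, map_mul, map_mul, ← h, ← h']; ring
  algebraMap_mem' c :=
    ⟨0, 1, c, ⟨by simp, 0, fun n _ => by simp⟩, one_mem _, by simp, by simp⟩

variable (A) in
/-- The `A`-submodule `A + 𝔪ⁱA'` of the total ring of fractions of `A`. -/
noncomputable def addPowNeighborhood (i : ℕ) : Submodule A (FractionRing A) :=
  (⊥ : Subalgebra A (FractionRing A)).toSubmodule ⊔
    maximalIdeal A ^ i • (firstNeighborhood A).toSubmodule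

variable (A) in
/-- The length `λ((A + 𝔪ⁱA') / (A + 𝔪ⁱ⁺¹A'))`. -/
noncomputable def microLength (i : ℕ) : ℕ∞ :=
  quotLength (addPowNeighborhood A i) (addPowNeighborhood A (i + 1))

variable (A) in
/-- The micro-invariants, for `i ≥ 1`:
`β i = λ((A + 𝔪ⁱ⁻¹A') / (A + 𝔪ⁱA')) - λ((A + 𝔪ⁱA') / (A + 𝔪ⁱ⁺¹A'))`. -/
noncomputable def microInvariant (i : ℕ) : ℤ :=
  ((microLength A (i - 1)).toNat : ℤ) - ((microLength A i).toNat : ℤ)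

/-! The Apery invariants and the lengths `ν` and `g` -/

/-- The Apery invariants `γ i = λ((𝔪ⁱ + xA) / (𝔪ⁱ⁺¹ + xA))`. -/
noncomputable def aperyInvariant (x : A) (i : ℕ) : ℕ∞ :=
  quotLength (maximalIdeal A ^ i ⊔ Ideal.span {x}) (maximalIdeal A ^ (i + 1) ⊔ Ideal.span {x})

/-- `ν i = λ((𝔪ⁱ ∩ xA + 𝔪ⁱ⁺¹) / (x𝔪ⁱ⁻¹ + 𝔪ⁱ⁺¹))`, for `i ≥ 1`. -/
noncomputable def nu (x : A) (i : ℕ) : ℕ∞ :=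
  quotLength (maximalIdeal A ^ i ⊓ Ideal.span {x} ⊔ maximalIdeal A ^ (i + 1))
    (Ideal.span {x} * maximalIdeal A ^ (i - 1) ⊔ maximalIdeal A ^ (i + 1))

/-- The colon ideal `(𝔪ʳ : xᵏ)` for an integer `k`, the set of `a` with `a xᵏ ∈ 𝔪ʳ`. For `k < 0`
and `x` regular this is `x⁻ᵏ 𝔪ʳ`. -/
noncomputable def colonPow (x : A) (r : ℕ) (k : ℤ) : Ideal A :=
  if 0 ≤ k then (maximalIdeal A ^ r).colon {x ^ k.toNat}
  else Ideal.span {x ^ (-k).toNat} * maximalIdeal A ^ r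

/-- `g i = λ((𝔪ʳ : xʳ⁻ⁱ) / (𝔪ⁱ + (𝔪ʳ : xʳ⁻ⁱ⁻¹)))`, with `r` the reduction number of `𝔪` with respect
to `xA`. -/
noncomputable def gLength (x : A) (i : ℕ) : ℕ∞ :=
  let r := reductionNumber (Ideal.span {x}) (maximalIdeal A)
  quotLength (colonPow x r ((r : ℤ) - i)) (maximalIdeal A ^ i ⊔ colonPow x r ((r : ℤ) - i - 1))

end TangentCone

/-! Write `k` for the residue field, `T` for multiplication by `x*` on `G(𝔪)`, and `c(i,n)` for the
rank of `T^(n-i)` from degree `i` to degree `n`. Every term of the formula can be computed from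
these ranks.

Since `𝔪^(r+1) = x𝔪^r` and `𝔪` contains a regular element, `x` is regular. Hence `F(x)` is the
polynomial ring `k[x*]`, and a decomposition of `G(𝔪)` amounts to a homogeneous basis for `T`, with
one generator per summand (`exists_isHomogBasis_of_equiv`, `exists_equiv_of_isHomogBasis`).
Existence is the graded structure theorem over `k[T]` (`exists_isHomogBasis`). Given a basis,
`c(i,n)` counts the summands born in degree at most `i` and still alive in degree `n`; it is also
the length of `𝔪^i / (𝔪^i ∩ (𝔪^(n+1) : x^(n-i)))` (`quotLength_powColon_eq_card`).

Two length computations then suffice. Filtering `𝔪^i/𝔪^(i+1)` gives `γ_i + ν_i = c(i,i) - c(i-1,i)`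
(`aperyInvariant_add_nu`), which is `α_i` plus the sum of all `α_{i,j}`. Since `A' = x^(-r)𝔪^r`, the
length of `(A + 𝔪^iA')/(A + 𝔪^(i+1)A')` is `c(r,r) - g_i - c(i,r)` (`microLength_add`,
`quotLength_powColon_powColon`), so `β_i = α_i + g_i - g_{i-1}`: no torsion generated in degree `i`
survives in degree `r`. Finally `α_{i,r-i} = 0`, because `T` is injective in degree `r-1`
(`torsion_eq_zero_of_card_eq`), and this removes the last term of the sum. -/

namespace TangentCone

open IsLocalRing

/-! ### Homogeneous bases of graded modules over a polynomial ring in one variable. -/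

section HomogeneousBases

variable {K V : Type*} [Field K] [AddCommGroup V] [Module K V]

/-- A finite family `y` of vectors `y s ∈ U (deg s)` such that the vectors `T ^ (n - deg s) (y s)`
with `deg s ≤ n < death s` form a basis of `U n` for every `n`, and vanish for `n ≥ death s`. -/
structure IsHomogBasis {ι : Type*} [Fintype ι] (T : V →ₗ[K] V) (U : ℕ → Submodule K V)
    (deg : ι → ℕ) (death : ι → ℕ∞) (y : ι → V) : Prop where
  mem : ∀ s, y s ∈ U (deg s)
  kill : ∀ s n, deg s ≤ n → death s ≤ (n : ℕ∞) → (T ^ (n - deg s)) (y s) = 0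
  span : ∀ n, ∀ v ∈ U n, ∃ c : ι → K,
    v = ∑ s with deg s ≤ n ∧ (n : ℕ∞) < death s, c s • (T ^ (n - deg s)) (y s)
  indep : ∀ n, ∀ c : ι → K,
    ∑ s with deg s ≤ n ∧ (n : ℕ∞) < death s, c s • (T ^ (n - deg s)) (y s) = 0 →
      ∀ s, deg s ≤ n → (n : ℕ∞) < death s → c s = 0

theorem pow_map_mem {T : V →ₗ[K] V} {U : ℕ → Submodule K V}
    (hT : ∀ n, ∀ v ∈ U n, T v ∈ U (n + 1)) {m : ℕ} {v : V} (hv : v ∈ U m) (k : ℕ) :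
    (T ^ k) v ∈ U (m + k) := by
  induction k with
  | zero => simpa using hv
  | succ k ih => rw [pow_succ', Module.End.mul_apply]; exact hT _ _ ih

/-- `T ^ (n - i)` carries the basis vector of `U i` attached to `s` to the one of `U n` attached to
`s`, or to zero when `s` has died by degree `n`. The survivors are part of a basis of `U n`, so the
rank is their number. -/
theorem IsHomogBasis.finrank_map {ι : Type*} [Fintype ι] {T : V →ₗ[K] V} {U : ℕ → Submodule K V}
    {deg : ι → ℕ} {death : ι → ℕ∞} {y : ι → V} (h : IsHomogBasis T U deg death y)
    (hT : ∀ n, ∀ v ∈ U n, T v ∈ U (n + 1)) {i n : ℕ} (hin : i ≤ n) :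
    Module.finrank K ((U i).map (T ^ (n - i))) =
      (Finset.univ.filter fun s => deg s ≤ i ∧ (n : ℕ∞) < death s).card := by
  classical
  set S := Finset.univ.filter fun s => deg s ≤ i ∧ (n : ℕ∞) < death s with hS
  let b : S → V := fun s => (T ^ (n - deg s.1)) (y s.1)
  have hb : LinearIndependent K b := by
    rw [Fintype.linearIndependent_iff]
    intro g hg s
    have hs := (Finset.mem_filter.1 s.2).2
    have := h.indep n (fun t => if ht : t ∈ S then g ⟨t, ht⟩ else 0) ?_ s.1 (hs.1.trans hin) hs.2
    · simpa using this
    · rw [← hg, ← Finset.sum_subset (s₁ := S), ← Finset.sum_coe_sort S]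
      · exact Finset.sum_congr rfl fun t _ => by simp [b]
      · intro t ht
        have ht := (Finset.mem_filter.1 ht).2
        simp [ht.1.trans hin, ht.2]
      · intro t _ ht
        rw [dif_neg ht, zero_smul]
  have hspan : (U i).map (T ^ (n - i)) = Submodule.span K (Set.range b) := by
    apply le_antisymm
    · rintro _ ⟨v, hv, rfl⟩
      obtain ⟨c, rfl⟩ := h.span i v hv
      rw [map_sum]
      refine Submodule.sum_mem _ fun s hs => ?_
      have hs := (Finset.mem_filter.1 hs).2
      rw [map_smul, ← Module.End.mul_apply, ← pow_add,
        show n - i + (i - deg s) = n - deg s by omega]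
      by_cases hn : (n : ℕ∞) < death s
      · exact Submodule.smul_mem _ _
          (Submodule.subset_span ⟨⟨s, by simp [hS, hs.1, hn]⟩, rfl⟩)
      · rw [h.kill s n (hs.1.trans hin) (not_lt.1 hn), smul_zero]
        exact zero_mem _
    · rw [Submodule.span_le]
      rintro _ ⟨s, rfl⟩
      have hs := (Finset.mem_filter.1 s.2).2
      refine ⟨(T ^ (i - deg s.1)) (y s.1), ?_, ?_⟩
      · have := pow_map_mem hT (h.mem s.1) (i - deg s.1)
        rwa [Nat.add_sub_cancel' hs.1] at this
      · rw [← Module.End.mul_apply, ← pow_add, show n - i + (i - deg s.1) = n - deg s.1 by omega]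
  rw [hspan, finrank_span_eq_card hb, Fintype.card_coe]

/-- A basis of `(L + P) / L` consisting of vectors of `P`, with a dual family of functionals. -/
theorem exists_relative_basis (L P : Submodule K V) [FiniteDimensional K P] :
    ∃ (m : ℕ) (b : Fin m → V) (φ : Fin m → V →ₗ[K] K), (∀ l, b l ∈ P) ∧
      P ≤ L ⊔ Submodule.span K (Set.range b) ∧ (∀ l, ∀ v ∈ L, φ l v = 0) ∧
      ∀ l l', φ l (b l') = if l = l' then 1 else 0 := by
  let Q := P.map L.mkQ
  let β : Module.Basis (Fin (Module.finrank K Q)) K Q := Module.finBasis K Q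
  have hβ : ∀ l, ∃ b ∈ P, L.mkQ b = (β l : V ⧸ L) := fun l => (β l).2
  choose b hbP hb using hβ
  choose φ hφ using fun l => LinearMap.exists_extend (β.coord l)
  refine ⟨_, b, fun l => φ l ∘ₗ L.mkQ, hbP, fun p hp => ?_, fun l v hv => ?_, fun l l' => ?_⟩
  · have h1 := congrArg (fun q : Q => (q : V ⧸ L)) (β.sum_repr ⟨L.mkQ p, p, hp, rfl⟩)
    simp only [AddSubmonoidClass.coe_finsetSum, SetLike.val_smul, ← hb, ← map_smul, ← map_sum] at h1
    rw [← sub_eq_zero, ← map_sub, ← LinearMap.mem_ker, Submodule.ker_mkQ] at h1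
    rw [← sub_sub_cancel (∑ l, β.repr ⟨L.mkQ p, p, hp, rfl⟩ l • b l) p]
    exact sub_mem (Submodule.mem_sup_right (Submodule.sum_mem _ fun l _ =>
      Submodule.smul_mem _ _ (Submodule.subset_span ⟨l, rfl⟩))) (Submodule.mem_sup_left h1)
  · rw [LinearMap.comp_apply, (LinearMap.mem_ker (f := L.mkQ)).1 (by simpa using hv), map_zero]
  · have := LinearMap.congr_fun (hφ l) (β l')
    rw [LinearMap.comp_apply, hb]
    simp only [LinearMap.comp_apply, Submodule.subtype_apply, Module.Basis.coord_apply,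
      Module.Basis.repr_self, Finsupp.single_apply] at this
    rw [this]
    simp [eq_comm]

/-- The degree of the generator of a summand. -/
def indexDeg (r : ℕ) (α : ℕ → ℕ) (τ : ℕ → ℕ → ℕ) : FreeIndex r α ⊕ TorsionIndex r τ → ℕ :=
  Sum.elim (fun s => s.1.1) (fun t => t.1.1.1)

/-- The degree from which on a summand is zero. -/
def indexDeath (r : ℕ) (α : ℕ → ℕ) (τ : ℕ → ℕ → ℕ) : FreeIndex r α ⊕ TorsionIndex r τ → ℕ∞ :=
  Sum.elim (fun _ => ⊤) (fun t => ((t.1.1.1 + t.1.1.2 : ℕ) : ℕ∞))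

theorem indexDeg_le_of_indexDeath_eq {r : ℕ} {α : ℕ → ℕ} {τ : ℕ → ℕ → ℕ}
    {s : FreeIndex r α ⊕ TorsionIndex r τ} {n : ℕ} (h : indexDeath r α τ s = n) :
    indexDeg r α τ s ≤ n := by
  rcases s with s | t
  · simp [indexDeath] at h
  · simp only [indexDeath, Sum.elim_inr, Nat.cast_inj] at h
    simp only [indexDeg, Sum.elim_inr]
    omega

/-- In a vanishing combination, take the generator of largest degree, and of largest death within
that degree, among those with nonzero coefficient. Pulled back to that degree, the relation becomes
an element killed by a power of `T`, hence by the functional of this generator. That functional also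
kills every other term, leaving only the chosen coefficient. -/
theorem homogBasis_indep_of_functionals {ι : Type*} [Fintype ι] {T : V →ₗ[K] V}
    {U : ℕ → Submodule K V} {deg : ι → ℕ} {death : ι → ℕ∞} {y : ι → V} (φ : ι → V →ₗ[K] K)
    (hT : ∀ n, ∀ v ∈ U n, T v ∈ U (n + 1)) (mem : ∀ s, y s ∈ U (deg s))
    (kill : ∀ s n, deg s ≤ n → death s ≤ (n : ℕ∞) → (T ^ (n - deg s)) (y s) = 0)
    (hdeath : ∀ s (n : ℕ), death s = n → deg s ≤ n)
    (hφT : ∀ s i, deg s = i + 1 → ∀ v ∈ U i, φ s (T v) = 0)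
    (hφK : ∀ s n, deg s ≤ n → (n : ℕ∞) < death s → ∀ v ∈ U (deg s),
      (T ^ (n - deg s)) v = 0 → φ s v = 0)
    (hφ : ∀ s, φ s (y s) = 1)
    (hφ' : ∀ s t, deg t = deg s → death t = death s → t ≠ s → φ s (y t) = 0)
    (n : ℕ) (c : ι → K)
    (hc : ∑ s with deg s ≤ n ∧ (n : ℕ∞) < death s, c s • (T ^ (n - deg s)) (y s) = 0)
    (s : ι) (hs : deg s ≤ n) (hs' : (n : ℕ∞) < death s) : c s = 0 := by
  classical
  by_contra hcs
  obtain ⟨s₀, hs₀, hmax⟩ := Finset.exists_max_image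
    (Finset.univ.filter fun s => (deg s ≤ n ∧ (n : ℕ∞) < death s) ∧ c s ≠ 0)
    (fun s => toLex (deg s, death s)) ⟨s, by simp [hs, hs', hcs]⟩
  obtain ⟨⟨h₁, h₂⟩, h₃⟩ := (Finset.mem_filter.1 hs₀).2
  have hmax' : ∀ t, deg t ≤ n → (n : ℕ∞) < death t → c t ≠ 0 →
      deg t < deg s₀ ∨ deg t = deg s₀ ∧ death t ≤ death s₀ := fun t ht ht' htc => by
    simpa [Prod.Lex.toLex_le_toLex] using hmax t (by simp [ht, ht', htc])
  set z := ∑ t with (deg t ≤ n ∧ (n : ℕ∞) < death t) ∧ deg t ≤ deg s₀,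
    c t • (T ^ (deg s₀ - deg t)) (y t) with hz
  have hzU : z ∈ U (deg s₀) := by
    refine Submodule.sum_mem _ fun t ht => Submodule.smul_mem _ _ ?_
    have ht := (Finset.mem_filter.1 ht).2
    have := pow_map_mem hT (mem t) (deg s₀ - deg t)
    rwa [Nat.add_sub_cancel' ht.2] at this
  have hzT : (T ^ (n - deg s₀)) z = 0 := by
    rw [← hc, hz, map_sum]
    refine Finset.sum_subset_zero_on_sdiff ?_ ?_ ?_
    · intro t ht
      simp only [Finset.mem_filter_univ] at ht ⊢
      exact ht.1
    · intro t ht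
      simp only [Finset.mem_sdiff, Finset.mem_filter_univ, not_and] at ht
      by_cases htc : c t = 0
      · rw [htc, zero_smul]
      · have := hmax' t ht.1.1 ht.1.2 htc
        exact absurd (by omega) (ht.2 ht.1)
    · intro t ht
      simp only [Finset.mem_filter_univ] at ht
      rw [map_smul, ← Module.End.mul_apply, ← pow_add,
        show n - deg s₀ + (deg s₀ - deg t) = n - deg t by omega]
  have h0 := hφK s₀ n h₁ h₂ z hzU hzT
  rw [hz, map_sum, Finset.sum_eq_single s₀] at h0
  · rw [Nat.sub_self, pow_zero, Module.End.one_apply, map_smul, hφ, smul_eq_mul, mul_one] at h0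
    exact h₃ h0
  · intro t ht hne
    simp only [Finset.mem_filter_univ] at ht
    by_cases htc : c t = 0
    · rw [htc, zero_smul, map_zero]
    rw [map_smul]
    convert smul_zero (c t)
    rcases hmax' t ht.1.1 ht.1.2 htc with hlt | ⟨heq, hle⟩
    · obtain ⟨k, hk⟩ := Nat.exists_eq_add_of_lt hlt
      rw [hk, show deg t + k + 1 - deg t = k + 1 by omega, pow_succ', Module.End.mul_apply]
      exact hφT s₀ _ hk _ (pow_map_mem hT (mem t) k)
    · rw [heq, Nat.sub_self, pow_zero, Module.End.one_apply]
      rcases hle.eq_or_lt with hd | hd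
      · exact hφ' s₀ t heq hd hne
      -- A generator of the same degree that dies earlier, at `d`, is itself torsion of an order
      -- that `φ s₀` annihilates.
      · obtain ⟨d, hd'⟩ := ENat.ne_top_iff_exists.1 (ne_top_of_lt hd)
        have hdeg := hdeath t d hd'.symm
        exact hφK s₀ d (heq ▸ hdeg) (hd' ▸ hd) _ (heq ▸ mem t)
          (heq ▸ kill t d hdeg hd'.symm.le)
  · intro h
    exact absurd (by simp [h₁, h₂]) h

/-- A graded module over `K[T]` which is generated in degrees `≤ r`, without `T`-torsion in the
degrees `0` and `≥ r`, and with finite-dimensional components has a homogeneous basis. -/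
theorem exists_isHomogBasis (T : V →ₗ[K] V) (U : ℕ → Submodule K V) (r : ℕ)
    [∀ n, FiniteDimensional K (U n)]
    (hT : ∀ n, ∀ v ∈ U n, T v ∈ U (n + 1))
    (hgen : ∀ n, r ≤ n → U (n + 1) ≤ (U n).map T)
    (hinj : ∀ n, r ≤ n → ∀ v ∈ U n, T v = 0 → v = 0)
    (hzero : ∀ n, ∀ v ∈ U 0, (T ^ n) v = 0 → v = 0) :
    ∃ (α : ℕ → ℕ) (τ : ℕ → ℕ → ℕ) (y : FreeIndex r α ⊕ TorsionIndex r τ → V),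
      IsHomogBasis T U (indexDeg r α τ) (indexDeath r α τ) y := by
  classical
  -- `I i` is the part of `U i` coming from lower degrees; new generators are chosen modulo it.
  obtain ⟨I, hI0, hI⟩ : ∃ I : ℕ → Submodule K V, I 0 = ⊥ ∧ ∀ i, I (i + 1) = (U i).map T :=
    ⟨fun i => Nat.casesOn i ⊥ fun i => (U i).map T, rfl, fun _ => rfl⟩
  let Z : ℕ → ℕ → Submodule K V := fun i j => U i ⊓ LinearMap.ker (T ^ j)
  have hZ : ∀ {i j v}, v ∈ Z i j ↔ v ∈ U i ∧ (T ^ j) v = 0 := Iff.rfl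
  have hZU : ∀ i j, Z i j ≤ U i := fun i j => inf_le_left
  have hZfin : ∀ i j, FiniteDimensional K (Z i j) := fun i j =>
    Submodule.finiteDimensional_of_le (hZU i j)
  have hZmono : ∀ i j j', j ≤ j' → Z i j ≤ Z i j' := fun i j j' hj v hv => by
    refine hZ.2 ⟨hv.1, ?_⟩
    rw [← Nat.sub_add_cancel hj, pow_add, Module.End.mul_apply, (hZ.1 hv).2,
      map_zero]
  -- Injectivity of `T` in degrees `≥ r` forces torsion of degree `i` to die by degree `r`, which
  -- bounds the orders `j` by `r - i`.
  have hZtop : ∀ i j, i ≤ r → Z i j ≤ Z i (r - i) := fun i j hi => by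
    rcases le_total j (r - i) with hj | hj
    · exact hZmono i j _ hj
    · obtain ⟨k, rfl⟩ := Nat.exists_eq_add_of_le hj
      induction k with
      | zero => exact le_rfl
      | succ k ih =>
        refine le_trans (fun v hv => ?_) (ih (by omega))
        obtain ⟨hv, hv'⟩ := hZ.1 hv
        refine hZ.2 ⟨hv, hinj _ ?_ _ (pow_map_mem hT hv _) ?_⟩
        · omega
        · rw [← Module.End.mul_apply, ← pow_succ']
          exact hv'
  -- Filter `U i` by `I i`, then by adding the kernels of `T, T², …`, and lastly by all of `U i`.
  -- The kernel steps give the torsion generators of each order, the last step the free ones.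
  choose τ b φ hbZ hbspan hφL hφb using fun i j => exists_relative_basis (I i ⊔ Z i (j - 1)) (Z i j)
  choose α g ψ hgU hgspan hψL hψg using fun i => exists_relative_basis (I i ⊔ Z i (r - i)) (U i)
  let y : FreeIndex r α ⊕ TorsionIndex r τ → V :=
    Sum.elim (fun s => g s.1.1 s.2) (fun t => b t.1.1.1 t.1.1.2 t.2)
  let Φ : FreeIndex r α ⊕ TorsionIndex r τ → V →ₗ[K] K :=
    Sum.elim (fun s => ψ s.1.1 s.2) (fun t => φ t.1.1.1 t.1.1.2 t.2)
  have mem : ∀ s, y s ∈ U (indexDeg r α τ s) := by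
    rintro (s | t)
    · exact hgU _ _
    · exact (hZ.1 (hbZ _ _ _)).1
  have kill : ∀ s n, indexDeg r α τ s ≤ n → indexDeath r α τ s ≤ (n : ℕ∞) →
      (T ^ (n - indexDeg r α τ s)) (y s) = 0 := by
    rintro (s | t) n h1 h2
    · simp [indexDeath] at h2
    · simp only [indexDeath, indexDeg, Sum.elim_inr, Nat.cast_le] at h1 h2 ⊢
      exact (hZ.1 (hZmono _ _ _ (by omega) (hbZ t.1.1.1 t.1.1.2 t.2))).2
  have hΦ : ∀ s, ∀ v ∈ I (indexDeg r α τ s), Φ s v = 0 := by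
    rintro (s | t) v hv
    · exact hψL _ _ _ (Submodule.mem_sup_left hv)
    · exact hφL _ _ _ _ (Submodule.mem_sup_left hv)
  refine ⟨α, τ, y, mem, kill, ?_, ?_⟩
  · let S : ℕ → Submodule K V := fun n => Submodule.span K
      ((fun s => (T ^ (n - indexDeg r α τ s)) (y s)) ''
        ↑(Finset.univ.filter fun s => indexDeg r α τ s ≤ n ∧ (n : ℕ∞) < indexDeath r α τ s))
    have hyS : ∀ n s, indexDeg r α τ s ≤ n → (T ^ (n - indexDeg r α τ s)) (y s) ∈ S n := by
      intro n s hs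
      by_cases hn : (n : ℕ∞) < indexDeath r α τ s
      · exact Submodule.subset_span ⟨s, by simp [hs, hn], rfl⟩
      · rw [kill s n hs (not_lt.1 hn)]
        exact zero_mem _
    have hyS' : ∀ s, y s ∈ S (indexDeg r α τ s) := fun s => by simpa using hyS _ s le_rfl
    have hTS : ∀ n, (S n).map T ≤ S (n + 1) := by
      intro n
      rw [Submodule.map_span, Submodule.span_le]
      rintro _ ⟨_, ⟨s, hs, rfl⟩, rfl⟩
      have hs := (Finset.mem_filter.1 hs).2.1
      have := hyS (n + 1) s (by omega)
      rwa [Nat.sub_add_comm hs, pow_succ', Module.End.mul_apply] at this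
    have hUS : ∀ n, U n ≤ S n := by
      intro n
      induction n with
      | zero =>
        refine (hgspan 0).trans (sup_le (sup_le (hI0 ▸ bot_le) ?_) (Submodule.span_le.2 ?_))
        -- There are no torsion summands in degree `0`; this is where `hzero` is needed.
        · intro v hv
          rw [hzero _ v hv.1 hv.2]
          exact zero_mem _
        · rintro _ ⟨l, rfl⟩
          exact hyS' (Sum.inl ⟨⟨0, by simp⟩, l⟩)
      | succ n ih =>
        have hIS : I (n + 1) ≤ S (n + 1) := by
          rw [hI]
          exact (Submodule.map_mono ih).trans (hTS n)
        rcases le_or_gt (n + 1) r with hn | hn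
        · have hZS : ∀ j, j ≤ r - (n + 1) → Z (n + 1) j ≤ S (n + 1) := by
            intro j hj
            induction j with
            | zero =>
              intro v hv
              rw [show v = 0 from hv.2]
              exact zero_mem _
            | succ j ihj =>
              refine (hbspan _ _).trans (sup_le (sup_le hIS (ihj (by omega)))
                (Submodule.span_le.2 ?_))
              rintro _ ⟨l, rfl⟩
              exact hyS' (Sum.inr ⟨⟨⟨n + 1, j + 1⟩, by simp; omega⟩, l⟩)
          refine (hgspan _).trans (sup_le (sup_le hIS (hZS _ le_rfl)) (Submodule.span_le.2 ?_))
          rintro _ ⟨l, rfl⟩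
          exact hyS' (Sum.inl ⟨⟨n + 1, by simp; omega⟩, l⟩)
        · exact (hgen n (by omega)).trans ((hI n).symm.le.trans hIS)
    intro n v hv
    obtain ⟨c, hc⟩ := (Submodule.mem_span_image_finset_iff_exists_fun' K).1 (hUS n hv)
    exact ⟨c, hc.symm⟩
  · refine homogBasis_indep_of_functionals Φ hT mem kill
      (fun s n h => indexDeg_le_of_indexDeath_eq h) (fun s i hi v hv => hΦ s _ ?_) ?_ ?_ ?_
    · rw [hi, hI]
      exact ⟨v, hv, rfl⟩
    · rintro (s | t) n h1 h2 v hv hTv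
      · exact hψL _ _ _ (Submodule.mem_sup_right (hZtop _ _ (Finset.mem_Icc.1 s.1.2).2 ⟨hv, hTv⟩))
      · refine hφL _ _ _ _ (Submodule.mem_sup_right (hZmono _ _ _ ?_ ⟨hv, hTv⟩))
        simp only [indexDeath, indexDeg, Sum.elim_inr, Nat.cast_lt] at h1 h2 ⊢
        omega
    · rintro (s | t)
      · simp [Φ, y, hψg]
      · simp [Φ, y, hφb]
    · rintro (⟨⟨i, hi⟩, l⟩ | ⟨⟨⟨i, j⟩, hij⟩, l⟩) (⟨⟨i', hi'⟩, l'⟩ | ⟨⟨⟨i', j'⟩, hij'⟩, l'⟩) h1 h2 h3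
      · simp only [indexDeg, Sum.elim_inl] at h1
        subst h1
        simp only [Φ, y, Sum.elim_inl, hψg]
        rw [if_neg]
        rintro rfl
        exact h3 rfl
      · exact absurd h2 (ENat.natCast_ne_top _)
      · exact absurd h2.symm (ENat.natCast_ne_top _)
      · simp only [indexDeg, Sum.elim_inr] at h1
        subst h1
        simp only [indexDeath, Sum.elim_inr, Nat.cast_inj, add_right_inj] at h2
        subst h2
        simp only [Φ, y, Sum.elim_inr, hφb]
        rw [if_neg]
        rintro rfl
        exact h3 rfl

end HomogeneousBases

variable {A : Type*} [CommRing A] [IsLocalRing A]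

/-! ### Graded pieces of the fiber cone as vector spaces over the residue field. -/

section FiberCone

/-- The element `a Tⁿ` of the Rees algebra. -/
noncomputable def reesMonomial (I : Ideal A) (n : ℕ) (a : ↥(I ^ n)) : ↥(reesAlgebra I) :=
  ⟨Polynomial.monomial n a.1, reesAlgebra.monomial_mem.2 a.2⟩

omit [IsLocalRing A] in
theorem reesMonomial_add (I : Ideal A) (n : ℕ) (a b : ↥(I ^ n)) :
    reesMonomial I n (a + b) = reesMonomial I n a + reesMonomial I n b :=
  Subtype.ext (by simp [reesMonomial])

omit [IsLocalRing A] in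
theorem sum_reesMonomial (I : Ideal A) (f : ↥(reesAlgebra I)) :
    ∑ n ∈ f.1.support, reesMonomial I n ⟨f.1.coeff n, f.2 n⟩ = f := by
  refine Subtype.ext ?_
  rw [AddSubmonoidClass.coe_finsetSum]
  conv_rhs => rw [f.1.as_sum_support]
  rfl

theorem reesMonomial_mem_map (I : Ideal A) (n : ℕ) (a : ↥(I ^ n))
    (ha : (a : A) ∈ maximalIdeal A * I ^ n) :
    reesMonomial I n a ∈ (maximalIdeal A).map (algebraMap A ↥(reesAlgebra I)) := by
  obtain ⟨a, ha'⟩ := a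
  refine Submodule.mul_induction_on' (C := fun a _ => ∀ ha' : a ∈ I ^ n,
    reesMonomial I n ⟨a, ha'⟩ ∈ (maximalIdeal A).map (algebraMap A ↥(reesAlgebra I)))
    (fun c hc b hb h => ?_) (fun b hb c hc h1 h2 h => ?_) ha ha'
  · have : reesMonomial I n ⟨c * b, h⟩ =
        reesMonomial I n ⟨b, hb⟩ * algebraMap A ↥(reesAlgebra I) c := by
      refine Subtype.ext ?_
      change Polynomial.monomial n (c * b) = Polynomial.monomial n b * Polynomial.C c
      rw [Polynomial.monomial_mul_C, mul_comm]
    rw [this]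
    exact Ideal.mul_mem_left _ _ (Ideal.mem_map_of_mem _ hc)
  · have hb' := Ideal.mul_le_right (I := maximalIdeal A) hb
    have hc' := Ideal.mul_le_right (I := maximalIdeal A) hc
    have := reesMonomial_add I n ⟨b, hb'⟩ ⟨c, hc'⟩
    exact this ▸ add_mem (h1 hb') (h2 hc')

/-- The extension of `𝔪` is a homogeneous ideal, so membership is tested degree by degree. This
makes the degree `n` piece equal to `Iⁿ / 𝔪Iⁿ`. -/
theorem mem_map_reesAlgebra_iff (I : Ideal A) (f : ↥(reesAlgebra I)) :
    f ∈ (maximalIdeal A).map (algebraMap A ↥(reesAlgebra I)) ↔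
      ∀ n, f.1.coeff n ∈ maximalIdeal A * I ^ n := by
  constructor
  · intro hf
    induction hf using Submodule.span_induction with
    | mem f hf =>
      obtain ⟨c, hc, rfl⟩ := hf
      intro n
      change (Polynomial.C c).coeff n ∈ _
      rw [Polynomial.coeff_C]
      split_ifs with h
      · simpa [h] using hc
      · exact zero_mem _
    | zero => exact fun n => zero_mem _
    | add f g _ _ hf hg =>
      intro n
      change (f.1 + g.1).coeff n ∈ _
      rw [Polynomial.coeff_add]
      exact add_mem (hf n) (hg n)
    | smul f g _ hg =>
      intro n
      change (f.1 * g.1).coeff n ∈ _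
      rw [Polynomial.coeff_mul]
      refine sum_mem fun p hp => ?_
      have := Ideal.mul_mem_mul (f.2 p.1) (hg p.2)
      rwa [mul_left_comm, ← pow_add, Finset.HasAntidiagonal.mem_antidiagonal.1 hp] at this
  · intro h
    rw [← sum_reesMonomial I f]
    exact sum_mem fun n _ => reesMonomial_mem_map I n _ (h n)

theorem FiberCone.mk_eq_zero_iff (I : Ideal A) (f : ↥(reesAlgebra I)) :
    FiberCone.mk I f = 0 ↔ ∀ n, f.1.coeff n ∈ maximalIdeal A * I ^ n :=
  Ideal.Quotient.eq_zero_iff_mem.trans (mem_map_reesAlgebra_iff I f)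

theorem FiberCone.mk_surjective (I : Ideal A) : Function.Surjective (FiberCone.mk I) :=
  Ideal.Quotient.mk_surjective

theorem FiberCone.mk_algebraMap_eq_zero (I : Ideal A) (c : A) (hc : c ∈ maximalIdeal A) :
    FiberCone.mk I (algebraMap A ↥(reesAlgebra I) c) = 0 :=
  Ideal.Quotient.eq_zero_iff_mem.2 (Ideal.mem_map_of_mem _ hc)

noncomputable instance (I : Ideal A) : Algebra (ResidueField A) (FiberCone I) :=
  (Ideal.Quotient.lift (maximalIdeal A) ((FiberCone.mk I).comp (algebraMap A ↥(reesAlgebra I)))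
    (FiberCone.mk_algebraMap_eq_zero I)).toAlgebra

theorem FiberCone.algebraMap_residue (I : Ideal A) (c : A) :
    algebraMap (ResidueField A) (FiberCone I) (residue A c) =
      FiberCone.mk I (algebraMap A ↥(reesAlgebra I) c) := rfl

/-- The class of `a Tⁿ` in the fiber cone. -/
noncomputable def FiberCone.hom (I : Ideal A) (n : ℕ) (a : ↥(I ^ n)) : FiberCone I :=
  FiberCone.mk I (reesMonomial I n a)

theorem FiberCone.hom_add (I : Ideal A) (n : ℕ) (a b : ↥(I ^ n)) :
    FiberCone.hom I n (a + b) = FiberCone.hom I n a + FiberCone.hom I n b := by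
  rw [hom, reesMonomial_add, map_add]; rfl

theorem FiberCone.hom_smul (I : Ideal A) (n : ℕ) (c : A) (a : ↥(I ^ n)) :
    FiberCone.hom I n (c • a) = residue A c • FiberCone.hom I n a := by
  rw [Algebra.smul_def, algebraMap_residue, hom, hom, ← map_mul]
  congr 1
  refine Subtype.ext ?_
  change Polynomial.monomial n (c * a.1) = Polynomial.C c * Polynomial.monomial n a.1
  rw [Polynomial.C_mul_monomial]

theorem FiberCone.hom_mul (I : Ideal A) (m n : ℕ) (a : ↥(I ^ m)) (b : ↥(I ^ n))
    (h : (a : A) * b ∈ I ^ (m + n)) :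
    FiberCone.hom I m a * FiberCone.hom I n b = FiberCone.hom I (m + n) ⟨a * b, h⟩ := by
  rw [hom, hom, ← map_mul]
  congr 1
  refine Subtype.ext ?_
  change Polynomial.monomial m a.1 * Polynomial.monomial n b.1 = Polynomial.monomial (m + n) _
  rw [Polynomial.monomial_mul_monomial]

theorem FiberCone.hom_eq_zero_iff (I : Ideal A) (n : ℕ) (a : ↥(I ^ n)) :
    FiberCone.hom I n a = 0 ↔ (a : A) ∈ maximalIdeal A * I ^ n := by
  rw [hom, mk_eq_zero_iff]
  constructor
  · intro h
    simpa [reesMonomial] using h n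
  · intro h m
    change (Polynomial.monomial n a.1).coeff m ∈ _
    rw [Polynomial.coeff_monomial]
    split_ifs with hm
    · exact hm ▸ h
    · exact zero_mem _

theorem FiberCone.mem_component_iff (I : Ideal A) (n : ℕ) (z : FiberCone I) :
    z ∈ FiberCone.component I n ↔ ∃ a : ↥(I ^ n), FiberCone.hom I n a = z :=
  ⟨fun ⟨a, ha, h⟩ => ⟨⟨a, ha⟩, h.symm⟩, fun ⟨a, h⟩ => ⟨a.1, a.2, h.symm⟩⟩

theorem FiberCone.exists_sum_hom (I : Ideal A) (z : FiberCone I) :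
    ∃ (S : Finset ℕ) (a : ∀ n, ↥(I ^ n)), z = ∑ n ∈ S, FiberCone.hom I n (a n) := by
  obtain ⟨f, rfl⟩ := FiberCone.mk_surjective I z
  refine ⟨f.1.support, fun n => ⟨f.1.coeff n, f.2 n⟩, ?_⟩
  conv_lhs => rw [← sum_reesMonomial I f, map_sum]
  rfl

/-- The component of degree `n` as a subspace. -/
noncomputable def FiberCone.piece (I : Ideal A) (n : ℕ) :
    Submodule (ResidueField A) (FiberCone I) where
  carrier := FiberCone.component I n
  add_mem' := by
    simp only [FiberCone.mem_component_iff]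
    rintro _ _ ⟨a, rfl⟩ ⟨b, rfl⟩
    exact ⟨a + b, FiberCone.hom_add I n a b⟩
  zero_mem' := (FiberCone.mem_component_iff I n _).2
    ⟨0, (FiberCone.hom_eq_zero_iff I n 0).2 (zero_mem _)⟩
  smul_mem' := by
    simp only [FiberCone.mem_component_iff]
    rintro c _ ⟨a, rfl⟩
    obtain ⟨c, rfl⟩ := residue_surjective c
    exact ⟨c • a, FiberCone.hom_smul I n c a⟩

theorem FiberCone.mem_piece {I : Ideal A} {n : ℕ} {z : FiberCone I} :
    z ∈ FiberCone.piece I n ↔ z ∈ FiberCone.component I n := Iff.rfl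

theorem FiberCone.hom_mem_piece (I : Ideal A) (n : ℕ) (a : ↥(I ^ n)) :
    FiberCone.hom I n a ∈ FiberCone.piece I n :=
  (FiberCone.mem_component_iff I n _).2 ⟨a, rfl⟩

/-- The projection of the fiber cone to its component of degree `n`. -/
noncomputable def FiberCone.proj (I : Ideal A) (n : ℕ) : FiberCone I →+ FiberCone I :=
  QuotientAddGroup.lift ((maximalIdeal A).map (algebraMap A ↥(reesAlgebra I))).toAddSubgroup
    { toFun := fun f => FiberCone.hom I n ⟨f.1.coeff n, f.2 n⟩
      map_zero' := (FiberCone.hom_eq_zero_iff I n _).2 (by simp)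
      map_add' := fun f g => by
        rw [← FiberCone.hom_add]
        exact congrArg _ (Subtype.ext (Polynomial.coeff_add _ _ _)) }
    (fun f hf => (FiberCone.hom_eq_zero_iff I n _).2 ((mem_map_reesAlgebra_iff I f).1 hf n))

theorem FiberCone.proj_mk (I : Ideal A) (n : ℕ) (f : ↥(reesAlgebra I)) :
    FiberCone.proj I n (FiberCone.mk I f) = FiberCone.hom I n ⟨f.1.coeff n, f.2 n⟩ := rfl

theorem FiberCone.proj_of_mem {I : Ideal A} {m n : ℕ} {z : FiberCone I}
    (hz : z ∈ FiberCone.piece I m) :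
    FiberCone.proj I n z = if m = n then z else 0 := by
  obtain ⟨a, rfl⟩ := (FiberCone.mem_component_iff I m _).1 hz
  rw [hom, proj_mk]
  split_ifs with h
  · subst h
    simp [reesMonomial, hom]
  · refine (hom_eq_zero_iff I n _).2 ?_
    simp [reesMonomial, Polynomial.coeff_monomial, h]

theorem FiberCone.map_hom {I J : Ideal A} (h : I ≤ J) (n : ℕ) (a : ↥(I ^ n)) :
    FiberCone.map h (FiberCone.hom I n a) =
      FiberCone.hom J n ⟨a, Ideal.pow_right_mono h n a.2⟩ := rfl

theorem FiberCone.map_algebraMap {I J : Ideal A} (h : I ≤ J) (c : ResidueField A) :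
    FiberCone.map h (algebraMap (ResidueField A) (FiberCone I) c) =
      algebraMap (ResidueField A) (FiberCone J) c := by
  obtain ⟨c, rfl⟩ := residue_surjective c
  rfl

end FiberCone

/-! ### The ring `F(x)` as a polynomial ring in `x*`. -/

section Principal

variable (x : A)

theorem xStar_pow (n : ℕ) (h : x ^ n ∈ Ideal.span {x} ^ n) :
    xStar x ^ n = FiberCone.hom (Ideal.span {x}) n ⟨x ^ n, h⟩ := by
  change FiberCone.mk _ _ ^ n = _
  rw [FiberCone.hom, ← map_pow]
  congr 1
  refine Subtype.ext ?_
  change (Polynomial.monomial 1 x) ^ n = Polynomial.monomial n (x ^ n)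
  rw [Polynomial.monomial_pow, one_mul]

theorem mem_component_span_iff (n : ℕ) (z : FiberCone (Ideal.span {x})) :
    z ∈ FiberCone.component (Ideal.span {x}) n ↔ ∃ c : ResidueField A, z = c • xStar x ^ n := by
  have hxn : x ^ n ∈ Ideal.span {x} ^ n := Ideal.pow_mem_pow (Ideal.mem_span_singleton_self x) n
  rw [FiberCone.mem_component_iff]
  constructor
  · rintro ⟨⟨a, ha⟩, rfl⟩
    rw [Ideal.span_singleton_pow, Ideal.mem_span_singleton'] at ha
    obtain ⟨c, rfl⟩ := ha
    exact ⟨residue A c, by rw [xStar_pow x n hxn, ← FiberCone.hom_smul]; rfl⟩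
  · rintro ⟨c, rfl⟩
    obtain ⟨c, rfl⟩ := residue_surjective c
    exact ⟨c • ⟨x ^ n, hxn⟩, by rw [xStar_pow x n hxn, ← FiberCone.hom_smul]⟩

-- If `c xⁿ` lies in `𝔪 xⁿ`, cancelling the regular element `xⁿ` puts `c` in `𝔪`. So every power of
-- `x*` is nonzero.
variable {x} in
theorem smul_xStar_pow_eq_zero (hx : x ∈ nonZeroDivisors A) {n : ℕ} {c : ResidueField A}
    (h : c • xStar x ^ n = 0) : c = 0 := by
  have hxn : x ^ n ∈ Ideal.span {x} ^ n := Ideal.pow_mem_pow (Ideal.mem_span_singleton_self x) n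
  obtain ⟨c, rfl⟩ := residue_surjective c
  rw [xStar_pow x n hxn, ← FiberCone.hom_smul, FiberCone.hom_eq_zero_iff] at h
  change c * x ^ n ∈ _ at h
  rw [Ideal.span_singleton_pow, mul_comm (maximalIdeal A), Ideal.mem_span_singleton_mul] at h
  obtain ⟨d, hd, h⟩ := h
  have : d = c :=
    (mul_cancel_right_mem_nonZeroDivisors (pow_mem hx n)).1 (by rw [← h, mul_comm])
  rw [residue_eq_zero_iff]
  exact this ▸ hd

theorem aeval_xStar_surjective : Function.Surjective
    (Polynomial.aeval (R := ResidueField A) (xStar x)) := by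
  intro z
  obtain ⟨S, a, rfl⟩ := FiberCone.exists_sum_hom _ z
  have : ∀ n, ∃ c : ResidueField A, FiberCone.hom _ n (a n) = c • xStar x ^ n := fun n =>
    (mem_component_span_iff x n _).1 (FiberCone.hom_mem_piece _ n (a n))
  choose c hc using this
  refine ⟨∑ n ∈ S, Polynomial.monomial n (c n), ?_⟩
  rw [map_sum]
  exact Finset.sum_congr rfl fun n _ => by rw [Polynomial.aeval_monomial, hc, Algebra.smul_def]

theorem smul_xStar_pow_mem (c : ResidueField A) (n : ℕ) :
    c • xStar x ^ n ∈ FiberCone.piece (Ideal.span {x}) n :=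
  (mem_component_span_iff x n _).2 ⟨c, rfl⟩

variable {x} in
theorem proj_aeval_xStar (n : ℕ) (p : Polynomial (ResidueField A)) :
    FiberCone.proj _ n (Polynomial.aeval (xStar x) p) = p.coeff n • xStar x ^ n := by
  rw [Polynomial.aeval_eq_sum_range, map_sum]
  simp_rw [FiberCone.proj_of_mem (smul_xStar_pow_mem x _ _)]
  rw [Finset.sum_ite_eq']
  split_ifs with h
  · rfl
  · rw [Polynomial.coeff_eq_zero_of_natDegree_lt (by simpa using h), zero_smul]

-- Together with `aeval_xStar_surjective`, this identifies `F(x)` with the polynomial ring over the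
-- residue field.
variable {x} in
theorem aeval_xStar_injective (hx : x ∈ nonZeroDivisors A) : Function.Injective
    (Polynomial.aeval (R := ResidueField A) (xStar x)) := by
  rw [injective_iff_map_eq_zero]
  intro p hp
  ext n
  have := proj_aeval_xStar (x := x) n p
  rw [hp, map_zero] at this
  exact smul_xStar_pow_eq_zero hx this.symm

variable {x} in
theorem aeval_xStar_mem_span_pow_iff (hx : x ∈ nonZeroDivisors A) (j : ℕ)
    (p : Polynomial (ResidueField A)) :
    Polynomial.aeval (xStar x) p ∈ Ideal.span {xStar x ^ j} ↔ ∀ n < j, p.coeff n = 0 := by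
  rw [← Polynomial.X_pow_dvd_iff, Ideal.mem_span_singleton]
  constructor
  · rintro ⟨q, hq⟩
    obtain ⟨q, rfl⟩ := aeval_xStar_surjective x q
    refine ⟨q, aeval_xStar_injective hx ?_⟩
    rw [hq, map_mul, map_pow, Polynomial.aeval_X]
  · rintro ⟨q, rfl⟩
    exact ⟨Polynomial.aeval (xStar x) q, by rw [map_mul, map_pow, Polynomial.aeval_X]⟩

variable {x} in
theorem smul_xStar_pow_mem_span (hx : x ∈ nonZeroDivisors A) {n j : ℕ} (hn : n < j)
    {c : ResidueField A} (h : c • xStar x ^ n ∈ Ideal.span {xStar x ^ j}) : c = 0 := by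
  have : c • xStar x ^ n = Polynomial.aeval (xStar x) (Polynomial.monomial n c) := by
    rw [Polynomial.aeval_monomial, Algebra.smul_def]
  rw [this, aeval_xStar_mem_span_pow_iff hx] at h
  simpa using h n hn

end Principal

/-! ### Homogeneous elements of the direct sum of shifted cyclic modules. -/

section Model

variable (x : A) (r : ℕ) (α : ℕ → ℕ) (τ : ℕ → ℕ → ℕ)

/-- The direct sum of the free and the torsion summands. -/
abbrev ConeModel : Type _ :=
  (FreeIndex r α → FiberCone (Ideal.span {x})) ×
    ((t : TorsionIndex r τ) → FiberCone (Ideal.span {x}) ⧸ Ideal.span {xStar x ^ t.1.1.2})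

/-- The elements `v` of the direct sum that are homogeneous of degree `n`. -/
def ConeModel.IsHomog (n : ℕ) (v : ConeModel x r α τ) : Prop :=
  (∀ s : FreeIndex r α, InShift x s.1.1 n (v.1 s)) ∧
    ∀ t : TorsionIndex r τ, InShiftQuot x t.1.1.2 t.1.1.1 n (v.2 t)

open Classical in
/-- The generators of the summands. -/
noncomputable def ConeModel.gen : FreeIndex r α ⊕ TorsionIndex r τ → ConeModel x r α τ :=
  Sum.elim (fun s => (Pi.single s 1, 0)) (fun t => (0, Pi.single t 1))

/-- The homogeneous element of degree `n` with given coefficients. -/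
noncomputable def ConeModel.homogElem (n : ℕ)
    (c : FreeIndex r α ⊕ TorsionIndex r τ → ResidueField A) : ConeModel x r α τ :=
  (fun s => if s.1.1 ≤ n then c (Sum.inl s) • xStar x ^ (n - s.1.1) else 0,
    fun t => Ideal.Quotient.mk _
      (if t.1.1.1 ≤ n then c (Sum.inr t) • xStar x ^ (n - t.1.1.1) else 0))

variable {x r α τ}

theorem smul_xStar_pow_mem_span_of_le {j m : ℕ} (h : j ≤ m) (c : ResidueField A) :
    c • xStar x ^ m ∈ Ideal.span {xStar x ^ j} := by
  rw [Algebra.smul_def]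
  exact Ideal.mul_mem_left _ _ (Ideal.mem_span_singleton.2 (pow_dvd_pow _ h))

/-- Only generators alive in degree `n` contribute: in a dead torsion summand the exponent of `x*`
is at least `j`, so the class vanishes whatever the coefficient. -/
theorem ConeModel.homogElem_eq_sum (n : ℕ)
    (c : FreeIndex r α ⊕ TorsionIndex r τ → ResidueField A) :
    homogElem x r α τ n c =
      ∑ s with indexDeg r α τ s ≤ n ∧ (n : ℕ∞) < indexDeath r α τ s,
        (c s • xStar x ^ (n - indexDeg r α τ s)) • gen x r α τ s := by
  classical
  refine Prod.ext (funext fun s => ?_) (funext fun t => ?_)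
  · rw [Prod.fst_sum, Finset.sum_apply, Finset.sum_filter, Fintype.sum_sum_type,
      Finset.sum_eq_single s, Finset.sum_eq_zero (s := Finset.univ (α := TorsionIndex r τ)), add_zero]
    · simp [homogElem, gen, indexDeg, indexDeath]
    · intro t _
      simp [gen]
    · intro b _ hb
      simp [gen, Pi.single_eq_of_ne hb.symm]
    · simp
  · rw [Prod.snd_sum, Finset.sum_apply, Finset.sum_filter, Fintype.sum_sum_type,
      Finset.sum_eq_zero (s := Finset.univ (α := FreeIndex r α)), zero_add,
      Finset.sum_eq_single t]
    · rw [Prod.smul_snd, Pi.smul_apply]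
      simp only [homogElem, gen, indexDeg, indexDeath, Sum.elim_inr, Pi.single_eq_same,
        Nat.cast_lt]
      by_cases h1 : t.1.1.1 ≤ n
      · rw [if_pos h1]
        by_cases h2 : n < t.1.1.1 + t.1.1.2
        · rw [if_pos ⟨h1, h2⟩, ← map_one (Ideal.Quotient.mk _)]
          exact congrArg (Ideal.Quotient.mk _) (mul_one _).symm
        · rw [if_neg fun h => h2 h.2]
          exact Ideal.Quotient.eq_zero_iff_mem.2 (smul_xStar_pow_mem_span_of_le (by omega) _)
      · rw [if_neg h1, if_neg fun h => h1 h.1, map_zero]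
    · intro b _ hb
      simp [gen, Pi.single_eq_of_ne hb.symm]
    · simp
    · intro s _
      simp [gen]

theorem ConeModel.isHomog_iff (n : ℕ) (v : ConeModel x r α τ) :
    IsHomog x r α τ n v ↔ ∃ c, v = homogElem x r α τ n c := by
  have key : ∀ i (w : FiberCone (Ideal.span {x})), InShift x i n w ↔
      ∃ c : ResidueField A, w = if i ≤ n then c • xStar x ^ (n - i) else 0 := by
    intro i w
    simp only [InShift, mem_component_span_iff]
    by_cases h : i ≤ n
    · simp only [h, true_and, if_true]
      exact ⟨fun h => h.elim id fun h => ⟨0, by rw [h, zero_smul]⟩, Or.inl⟩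
    · simp [h]
  constructor
  · rintro ⟨h1, h2⟩
    choose c hc using fun s => (key _ _).1 (h1 s)
    choose w hw hwv using h2
    choose d hd using fun t => (key _ _).1 (hw t)
    exact ⟨Sum.elim c d, Prod.ext (funext hc) (funext fun t => by rw [← hwv, hd]; rfl)⟩
  · rintro ⟨c, rfl⟩
    exact ⟨fun s => (key _ _).2 ⟨_, rfl⟩, fun t => ⟨_, (key _ _).2 ⟨_, rfl⟩, rfl⟩⟩

theorem ConeModel.isHomog_gen (s : FreeIndex r α ⊕ TorsionIndex r τ) :
    IsHomog x r α τ (indexDeg r α τ s) (gen x r α τ s) := by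
  have h1 : ∀ i, InShift x i i 1 := fun i =>
    Or.inl ⟨le_rfl, (mem_component_span_iff x _ _).2 ⟨1, by simp⟩⟩
  rcases s with s | t
  · refine ⟨fun s' => ?_, fun t' => ⟨0, Or.inr rfl, map_zero _⟩⟩
    by_cases h : s' = s
    · subst h
      simpa [gen, indexDeg] using h1 s'.1.1
    · exact Or.inr (by simp [gen, Pi.single_eq_of_ne h])
  · refine ⟨fun s' => Or.inr rfl, fun t' => ?_⟩
    by_cases h : t' = t
    · subst h
      exact ⟨1, h1 _, by simp [gen]⟩
    · exact ⟨0, Or.inr rfl, by simp [gen, Pi.single_eq_of_ne h]⟩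

theorem ConeModel.smul_gen_eq_zero (s : FreeIndex r α ⊕ TorsionIndex r τ) (n : ℕ)
    (h1 : indexDeg r α τ s ≤ n) (h2 : indexDeath r α τ s ≤ (n : ℕ∞)) :
    (xStar x ^ (n - indexDeg r α τ s)) • gen x r α τ s = 0 := by
  rcases s with s | t
  · simp [indexDeath] at h2
  · simp only [indexDeath, indexDeg, Sum.elim_inr, Nat.cast_le] at h1 h2 ⊢
    refine Prod.ext (smul_zero _) (funext fun t' => ?_)
    rw [Prod.smul_snd, Pi.smul_apply]
    by_cases h : t' = t
    · subst h
      simp only [gen, Sum.elim_inr, Pi.single_eq_same]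
      rw [← map_one (Ideal.Quotient.mk _)]
      exact Ideal.Quotient.eq_zero_iff_mem.2 (Ideal.mul_mem_right _ _
        (Ideal.mem_span_singleton.2 (pow_dvd_pow _ (by omega))))
    · simp [gen, Pi.single_eq_of_ne h]

theorem ConeModel.eq_zero_of_homogElem_eq_zero (hx : x ∈ nonZeroDivisors A) {n : ℕ}
    {c : FreeIndex r α ⊕ TorsionIndex r τ → ResidueField A} (h : homogElem x r α τ n c = 0)
    (s : FreeIndex r α ⊕ TorsionIndex r τ) (hs : indexDeg r α τ s ≤ n)
    (hs' : (n : ℕ∞) < indexDeath r α τ s) : c s = 0 := by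
  rcases s with s | t
  · have := congrFun (congrArg Prod.fst h) s
    simp only [indexDeg, Sum.elim_inl] at hs
    simp only [homogElem, hs, if_true] at this
    exact smul_xStar_pow_eq_zero hx this
  · have := congrFun (congrArg Prod.snd h) t
    simp only [indexDeg, indexDeath, Sum.elim_inr, Nat.cast_lt] at hs hs'
    simp only [homogElem, hs, if_true] at this
    exact smul_xStar_pow_mem_span hx (by omega) (Ideal.Quotient.eq_zero_iff_mem.1 this)

end Model

/-! ### Graded decompositions of the tangent cone correspond to homogeneous bases. -/

section Invariants

variable {x : A} (hx : Ideal.span {x} ≤ maximalIdeal A)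

/-- Multiplication by `x*` on the tangent cone. -/
noncomputable def xStarMul : FiberCone (maximalIdeal A) →ₗ[ResidueField A] FiberCone (maximalIdeal A) :=
  LinearMap.mulLeft (ResidueField A) (FiberCone.map hx (xStar x))

theorem xStarMul_pow_apply (n : ℕ) (z : FiberCone (maximalIdeal A)) :
    (xStarMul hx ^ n) z = FiberCone.map hx (xStar x) ^ n * z := by
  rw [xStarMul, LinearMap.pow_mulLeft, LinearMap.mulLeft_apply]

theorem map_smul_xStar_pow_mul (c : ResidueField A) (n : ℕ) (z : FiberCone (maximalIdeal A)) :
    FiberCone.map hx (c • xStar x ^ n) * z = c • (xStarMul hx ^ n) z := by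
  rw [Algebra.smul_def, map_mul, FiberCone.map_algebraMap, map_pow, xStarMul_pow_apply, mul_assoc,
    Algebra.smul_def]

theorem xStarMul_pow_hom (k n : ℕ) (a : ↥(maximalIdeal A ^ n))
    (h : x ^ k * a ∈ maximalIdeal A ^ (n + k)) :
    (xStarMul hx ^ k) (FiberCone.hom _ n a) = FiberCone.hom _ (n + k) ⟨x ^ k * a, h⟩ := by
  have hxk : x ^ k ∈ Ideal.span {x} ^ k := Ideal.pow_mem_pow (Ideal.mem_span_singleton_self x) k
  have h' : (a : A) * x ^ k ∈ maximalIdeal A ^ (n + k) := mul_comm (x ^ k) (a : A) ▸ h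
  rw [xStarMul_pow_apply, ← map_pow, xStar_pow x k hxk, FiberCone.map_hom, mul_comm,
    FiberCone.hom_mul _ _ _ _ _ h']
  congr 1
  exact Subtype.ext (mul_comm _ _)

theorem xStarMul_mem (n : ℕ) (v : FiberCone (maximalIdeal A))
    (hv : v ∈ FiberCone.piece (maximalIdeal A) n) :
    xStarMul hx v ∈ FiberCone.piece (maximalIdeal A) (n + 1) := by
  obtain ⟨a, rfl⟩ := (FiberCone.mem_component_iff _ _ _).1 hv
  have hxa : x ^ 1 * a ∈ maximalIdeal A ^ (n + 1) := by
    rw [pow_succ', pow_one]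
    exact Ideal.mul_mem_mul (hx (Ideal.mem_span_singleton_self x)) a.2
  rw [← pow_one (xStarMul hx), xStarMul_pow_hom hx 1 n a hxa]
  exact FiberCone.hom_mem_piece _ _ _

/-- The basis consists of the images of the generators of the summands. -/
theorem exists_isHomogBasis_of_equiv (hreg : x ∈ nonZeroDivisors A) {r : ℕ}
    {α : ℕ → ℕ} {τ : ℕ → ℕ → ℕ} (e : ConeModel x r α τ ≃+ FiberCone (maximalIdeal A))
    (he : ∀ f v, e (f • v) = FiberCone.map hx f * e v)
    (hgr : ∀ n v, ConeModel.IsHomog x r α τ n v ↔ e v ∈ FiberCone.component (maximalIdeal A) n) :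
    ∃ y, IsHomogBasis (xStarMul hx) (FiberCone.piece (maximalIdeal A))
      (indexDeg r α τ) (indexDeath r α τ) y := by
  have hehom : ∀ n c, e (ConeModel.homogElem x r α τ n c) =
      ∑ s with indexDeg r α τ s ≤ n ∧ (n : ℕ∞) < indexDeath r α τ s,
        c s • (xStarMul hx ^ (n - indexDeg r α τ s)) (e (ConeModel.gen x r α τ s)) := by
    intro n c
    rw [ConeModel.homogElem_eq_sum, map_sum]
    exact Finset.sum_congr rfl fun s _ => by rw [he, map_smul_xStar_pow_mul]
  refine ⟨fun s => e (ConeModel.gen x r α τ s), ?_, ?_, ?_, ?_⟩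
  · exact fun s => (hgr _ _).1 (ConeModel.isHomog_gen s)
  · intro s n h1 h2
    rw [xStarMul_pow_apply, ← map_pow, ← he, ConeModel.smul_gen_eq_zero s n h1 h2, map_zero]
  · intro n v hv
    rw [← e.apply_symm_apply v, FiberCone.mem_piece, ← hgr, ConeModel.isHomog_iff] at hv
    obtain ⟨c, hc⟩ := hv
    exact ⟨c, by rw [← hehom, ← hc, e.apply_symm_apply]⟩
  · intro n c hc
    rw [← hehom, map_eq_zero_iff e e.injective] at hc
    exact ConeModel.eq_zero_of_homogElem_eq_zero hreg hc

/-- Taking the degree `n` part of a polynomial multiple of `y` isolates one coefficient. This turns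
a relation over `F(x)` into linear relations over the residue field. -/
theorem proj_map_aeval_mul {d : ℕ} {y : FiberCone (maximalIdeal A)}
    (hy : y ∈ FiberCone.piece (maximalIdeal A) d) (p : Polynomial (ResidueField A)) (n : ℕ) :
    FiberCone.proj _ n (FiberCone.map hx (Polynomial.aeval (xStar x) p) * y) =
      if d ≤ n then p.coeff (n - d) • (xStarMul hx ^ (n - d)) y else 0 := by
  have : ∀ m, p.coeff m • (xStarMul hx ^ m) y ∈ FiberCone.piece (maximalIdeal A) (d + m) :=
    fun m => Submodule.smul_mem _ _ (pow_map_mem (xStarMul_mem hx) hy m)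
  rw [Polynomial.aeval_eq_sum_range, map_sum, Finset.sum_mul, map_sum]
  simp_rw [map_smul_xStar_pow_mul, FiberCone.proj_of_mem (this _)]
  split_ifs with h
  · rw [Finset.sum_eq_single (n - d)]
    · rw [if_pos (by omega)]
    · intro m _ hm
      rw [if_neg (by omega)]
    · intro hm
      rw [Polynomial.coeff_eq_zero_of_natDegree_lt (not_le.1 fun h' => hm
        (Finset.mem_range_succ_iff.2 h')), zero_smul, ite_self]
  · exact Finset.sum_eq_zero fun m _ => if_neg (by omega)

/-- Send each generator to its basis vector; `kill` lets the map descend to the torsion summands.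
Bijectivity is checked in each degree, by `indep` and `span`. -/
theorem exists_equiv_of_isHomogBasis (hreg : x ∈ nonZeroDivisors A) {r : ℕ}
    {α : ℕ → ℕ} {τ : ℕ → ℕ → ℕ} {y}
    (h : IsHomogBasis (xStarMul hx) (FiberCone.piece (maximalIdeal A))
      (indexDeg r α τ) (indexDeath r α τ) y) :
    ∃ e : ConeModel x r α τ ≃+ FiberCone (maximalIdeal A),
      (∀ f v, e (f • v) = FiberCone.map hx f * e v) ∧
      ∀ n v, ConeModel.IsHomog x r α τ n v ↔ e v ∈ FiberCone.component (maximalIdeal A) n := by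
  classical
  let _ : Module (FiberCone (Ideal.span {x})) (FiberCone (maximalIdeal A)) :=
    Module.compHom _ (FiberCone.map hx)
  have hsmul : ∀ (f : FiberCone (Ideal.span {x})) (z : FiberCone (maximalIdeal A)),
      f • z = FiberCone.map hx f * z := fun _ _ => rfl
  let φ : ∀ s, FiberCone (Ideal.span {x}) →ₗ[FiberCone (Ideal.span {x})]
    FiberCone (maximalIdeal A) := fun s => LinearMap.toSpanSingleton _ _ (y s)
  have hφker : ∀ t : TorsionIndex r τ,
      Ideal.span {xStar x ^ t.1.1.2} ≤ LinearMap.ker (φ (Sum.inr t)) := by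
    intro t
    rw [Ideal.span_singleton_le_iff_mem, LinearMap.mem_ker]
    have := h.kill (Sum.inr t) (t.1.1.1 + t.1.1.2) (by simp [indexDeg]) (by simp [indexDeath])
    rw [xStarMul_pow_apply, ← map_pow] at this
    simpa [φ, hsmul, indexDeg] using this
  let ψ : ConeModel x r α τ →ₗ[FiberCone (Ideal.span {x})] FiberCone (maximalIdeal A) :=
    LinearMap.coprod (∑ s, φ (Sum.inl s) ∘ₗ LinearMap.proj s)
      (∑ t, (Submodule.liftQ _ (φ (Sum.inr t)) (hφker t)) ∘ₗ LinearMap.proj t)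
  have hψ : ∀ p : FreeIndex r α ⊕ TorsionIndex r τ → FiberCone (Ideal.span {x}),
      ψ (fun s => p (Sum.inl s), fun t => Ideal.Quotient.mk _ (p (Sum.inr t))) =
        ∑ s, FiberCone.map hx (p s) * y s := by
    intro p
    rw [Fintype.sum_sum_type]
    simp only [ψ, LinearMap.coprod_apply, LinearMap.sum_apply, LinearMap.comp_apply,
      LinearMap.proj_apply]
    rfl
  have hψhom : ∀ n c, ψ (ConeModel.homogElem x r α τ n c) =
      ∑ s with indexDeg r α τ s ≤ n ∧ (n : ℕ∞) < indexDeath r α τ s,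
        c s • (xStarMul hx ^ (n - indexDeg r α τ s)) (y s) := by
    intro n c
    refine (hψ fun s => if indexDeg r α τ s ≤ n then
      c s • xStar x ^ (n - indexDeg r α τ s) else 0).trans ?_
    rw [Finset.sum_filter]
    refine Finset.sum_congr rfl fun s _ => ?_
    by_cases h1 : indexDeg r α τ s ≤ n
    · rw [if_pos h1, map_smul_xStar_pow_mul]
      by_cases h2 : (n : ℕ∞) < indexDeath r α τ s
      · rw [if_pos ⟨h1, h2⟩]
      · rw [if_neg fun h => h2 h.2, h.kill s n h1 (not_lt.1 h2), smul_zero]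
    · rw [if_neg h1, if_neg fun h => h1 h.1, map_zero, zero_mul]
  have hψinj : Function.Injective ψ := by
    rw [injective_iff_map_eq_zero]
    intro v hv
    -- Represent every coordinate by a polynomial, so that its vanishing becomes a condition on
    -- coefficients: all of them for a free summand, those below `j` for a torsion one.
    obtain ⟨p, rfl⟩ : ∃ p : FreeIndex r α ⊕ TorsionIndex r τ → Polynomial (ResidueField A),
        v = (fun s => Polynomial.aeval (xStar x) (p (Sum.inl s)),
          fun t => Ideal.Quotient.mk _ (Polynomial.aeval (xStar x) (p (Sum.inr t)))) := by
      choose p hp using fun s => aeval_xStar_surjective x (v.1 s)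
      choose w hw using fun t => Ideal.Quotient.mk_surjective (v.2 t)
      choose q hq using fun t => aeval_xStar_surjective x (w t)
      exact ⟨Sum.elim p q, Prod.ext (funext fun s => (hp s).symm)
        (funext fun t => by simp [hq, hw])⟩
    rw [hψ (fun s => Polynomial.aeval (xStar x) (p s))] at hv
    have hcoeff : ∀ n s, indexDeg r α τ s ≤ n → (n : ℕ∞) < indexDeath r α τ s →
        (p s).coeff (n - indexDeg r α τ s) = 0 := by
      intro n
      refine h.indep n (fun s => (p s).coeff (n - indexDeg r α τ s)) ?_
      have := congrArg (FiberCone.proj _ n) hv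
      rw [map_zero, map_sum] at this
      rw [← this, Finset.sum_filter]
      refine Finset.sum_congr rfl fun s _ => ?_
      rw [proj_map_aeval_mul hx (h.mem s)]
      by_cases h1 : indexDeg r α τ s ≤ n
      · by_cases h2 : (n : ℕ∞) < indexDeath r α τ s
        · simp [h1, h2]
        · simp [h1, h2, h.kill s n h1 (not_lt.1 h2)]
      · simp [h1]
    refine Prod.ext (funext fun s => ?_) (funext fun t => ?_)
    · change Polynomial.aeval (xStar x) (p (Sum.inl s)) = 0
      convert map_zero (Polynomial.aeval (R := ResidueField A) (xStar x))
      ext m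
      have := hcoeff (m + s.1.1) (Sum.inl s) (by simp [indexDeg])
        (by simp only [indexDeath, Sum.elim_inl]; exact ENat.natCast_lt_top _)
      simpa [indexDeg] using this
    · refine Ideal.Quotient.eq_zero_iff_mem.2 ((aeval_xStar_mem_span_pow_iff hreg _ _).2 ?_)
      intro m hm
      have := hcoeff (m + t.1.1.1) (Sum.inr t) (by simp [indexDeg])
        (by simp only [indexDeath, Sum.elim_inr, Nat.cast_lt]; omega)
      simpa [indexDeg] using this
  have hψsurj : Function.Surjective ψ := by
    intro z
    obtain ⟨S, a, rfl⟩ := FiberCone.exists_sum_hom _ z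
    refine (LinearMap.mem_range (f := ψ)).1 (Submodule.sum_mem _ fun n _ => ?_)
    obtain ⟨c, hc⟩ := h.span n _ (FiberCone.hom_mem_piece _ n (a n))
    exact ⟨_, (hψhom n c).trans hc.symm⟩
  refine ⟨(LinearEquiv.ofBijective ψ ⟨hψinj, hψsurj⟩).toAddEquiv, fun f v => ψ.map_smul f v,
    fun n v => ?_⟩
  change ConeModel.IsHomog x r α τ n v ↔ ψ v ∈ FiberCone.piece _ n
  rw [ConeModel.isHomog_iff]
  constructor
  · rintro ⟨c, rfl⟩
    rw [hψhom]
    refine Submodule.sum_mem _ fun s hs => Submodule.smul_mem _ _ ?_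
    have hs := (Finset.mem_filter.1 hs).2.1
    have := pow_map_mem (xStarMul_mem hx) (h.mem s) (n - indexDeg r α τ s)
    rwa [Nat.add_sub_cancel' hs] at this
  · intro hv
    obtain ⟨c, hc⟩ := h.span n _ hv
    exact ⟨c, hψinj (hc.trans (hψhom n c).symm)⟩

end Invariants

/-! ### Calculus of lengths of subquotients. -/

section QuotLength

variable {R M M' : Type*} [CommRing R] [AddCommGroup M] [Module R M] [AddCommGroup M'] [Module R M']

theorem quotLength_add {N P Q : Submodule R M} (h1 : N ≤ P) (h2 : P ≤ Q) :
    quotLength Q N = quotLength Q P + quotLength P N := by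
  rw [add_comm]
  refine Module.length_eq_add_of_exact
    (Submodule.mapQ (N.submoduleOf P) (N.submoduleOf Q) (Submodule.inclusion h2) fun _ h => h)
    (Submodule.factor (Submodule.comap_mono h1 : N.submoduleOf Q ≤ P.submoduleOf Q)) ?_
    (Submodule.factor_surjective _) ?_
  · rw [← LinearMap.ker_eq_bot, LinearMap.ker_eq_bot']
    intro z hz
    obtain ⟨z, rfl⟩ := Submodule.mkQ_surjective _ z
    exact (Submodule.Quotient.mk_eq_zero _).2 <|
      (Submodule.Quotient.mk_eq_zero (N.submoduleOf Q) (x := Submodule.inclusion h2 z)).1 hz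
  · intro z
    obtain ⟨z, rfl⟩ := Submodule.mkQ_surjective _ z
    constructor
    · intro hz
      exact ⟨Submodule.Quotient.mk ⟨z, (Submodule.Quotient.mk_eq_zero (P.submoduleOf Q)).1 hz⟩, rfl⟩
    · rintro ⟨w, hw⟩
      obtain ⟨w, rfl⟩ := Submodule.mkQ_surjective _ w
      rw [← hw]
      exact (Submodule.Quotient.mk_eq_zero _).2 w.2

/-- `quotLength P N` makes sense without `N ≤ P`, and is then the length of `P / (P ∩ N)`. The colon
ideals below are used in this way. -/
theorem quotLength_inf (P N : Submodule R M) : quotLength P (P ⊓ N) = quotLength P N := by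
  rw [quotLength, quotLength, Submodule.submoduleOf, Submodule.submoduleOf, Submodule.comap_inf,
    Submodule.comap_subtype_self, top_inf_eq]

theorem quotLength_map (f : M →ₗ[R] M') (P : Submodule R M) (N : Submodule R M') :
    quotLength (P.map f) N = quotLength P (N.comap f) := by
  let g : P →ₗ[R] ↥(P.map f) ⧸ N.submoduleOf (P.map f) := Submodule.mkQ _ ∘ₗ f.submoduleMap P
  have hg : Function.Surjective g :=
    (Submodule.mkQ_surjective _).comp (f.submoduleMap_surjective P)
  have hker : LinearMap.ker g = (N.comap f).submoduleOf P := by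
    ext z
    exact Submodule.Quotient.mk_eq_zero _
  rw [quotLength, quotLength, ← hker]
  exact (g.quotKerEquivOfSurjective hg).length_eq.symm

theorem mem_map_iff_of_injective {f : M →ₗ[R] M'} (hf : Function.Injective f) {P : Submodule R M}
    {a : M} : f a ∈ P.map f ↔ a ∈ P :=
  hf.mem_set_image

theorem quotLength_map_map {f : M →ₗ[R] M'} (hf : Function.Injective f) (P N : Submodule R M) :
    quotLength (P.map f) (N.map f) = quotLength P N := by
  rw [quotLength_map, Submodule.comap_map_eq_of_injective hf]

theorem quotLength_sup (P N : Submodule R M) : quotLength (P ⊔ N) N = quotLength P N := by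
  have h := (LinearMap.quotientInfEquivSupQuotient P N).length_eq
  rw [Submodule.comap_subtype_self, top_inf_eq] at h
  exact h.symm

theorem quotLength_sup_sup {D D' : Submodule R M} (B : Submodule R M) (h : D' ≤ D) :
    quotLength (D ⊔ B) (D' ⊔ B) = quotLength D (D ⊓ B ⊔ D') := by
  rw [show D ⊔ B = D ⊔ (D' ⊔ B) by rw [← sup_assoc, sup_eq_left.2 h], quotLength_sup,
    ← quotLength_inf, sup_comm D' B, inf_sup_assoc_of_le B h]

/-- `D / D'` maps onto the first quotient with kernel `(D ∩ im f + D') / D'`, which `f` identifies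
with the quotient of the preimages. -/
theorem quotLength_sup_sup_add {D D' : Submodule R M'} (f : M →ₗ[R] M') (h : D' ≤ D) :
    quotLength (LinearMap.range f ⊔ D) (LinearMap.range f ⊔ D') +
      quotLength (D.comap f) (D'.comap f) = quotLength D D' := by
  rw [← quotLength_map, Submodule.map_comap_eq, inf_comm, sup_comm _ D, sup_comm _ D',
    quotLength_sup_sup _ h, ← quotLength_sup _ D', ← quotLength_add le_sup_right]
  exact sup_le inf_le_left h

variable [IsLocalRing R]

/-- Since `R` surjects onto its residue field, the `R`-submodules of `W` are its subspaces, and the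
two lengths agree. -/
theorem quotLength_eq_of_semilinear {W : Type*} [AddCommGroup W] [Module (ResidueField R) W]
    (P N : Submodule R M) (g : P →ₛₗ[residue R] W) (hg : Function.Surjective g)
    (hker : ∀ p : P, g p = 0 ↔ (p : M) ∈ N) :
    quotLength P N = Module.length (ResidueField R) W := by
  let _ : Module R W := Module.compHom W (residue R)
  have : IsScalarTower R (ResidueField R) W :=
    ⟨fun a b w => by rw [Algebra.smul_def, mul_smul]; rfl⟩
  let g' : P →ₗ[R] W := { toFun := g, map_add' := map_add g, map_smul' := fun c p => map_smulₛₗ g c p }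
  have hg' : LinearMap.ker g' = N.submoduleOf P := Submodule.ext hker
  rw [quotLength, ← hg', (g'.quotKerEquivOfSurjective hg).length_eq]
  exact (Module.length_eq_of_surjective (S := R) (R := ResidueField R) residue_surjective)

end QuotLength

theorem exists_mem_nonZeroDivisors_of_isCohenMacaulayLocal (hCM : IsCohenMacaulayLocal A)
    (hdim : ringKrullDim A = 1) : ∃ y ∈ maximalIdeal A, y ∈ nonZeroDivisors A := by
  obtain ⟨-, rs, hmem, hreg, hlen⟩ := hCM
  rw [hdim] at hlen
  have hlen : rs.length = 1 := by exact_mod_cast hlen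
  obtain ⟨y, rfl⟩ := List.length_eq_one_iff.1 hlen
  refine ⟨y, hmem y (by simp), ?_⟩
  have := ((RingTheory.Sequence.isWeaklyRegular_cons_iff A y []).1 hreg.toIsWeaklyRegular).1
  rw [mem_nonZeroDivisors_iff_right]
  intro z hz
  refine this ?_
  simpa [mul_comm] using hz

/-! ### Consequences of `𝔪^(r+1) = x𝔪^r`: colon ideals and length formulas. -/

section Reduction

variable {x : A} {r : ℕ}

theorem pow_add_eq_of_pow_succ_eq
    (hr : maximalIdeal A ^ (r + 1) = Ideal.span {x} * maximalIdeal A ^ r) {n : ℕ} (hn : r ≤ n)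
    (k : ℕ) : maximalIdeal A ^ (n + k) = Ideal.span {x ^ k} * maximalIdeal A ^ n := by
  have h1 : ∀ m, r ≤ m → maximalIdeal A ^ (m + 1) = Ideal.span {x} * maximalIdeal A ^ m := by
    intro m hm
    obtain ⟨d, rfl⟩ := Nat.exists_eq_add_of_le hm
    rw [add_right_comm, pow_add, hr, mul_assoc, ← pow_add]
  induction k with
  | zero => simp
  | succ k ih =>
    rw [← add_assoc, h1 _ (by omega), ih, ← mul_assoc, Ideal.span_singleton_mul_span_singleton,
      pow_succ']

/-- The regular element `y^(r+1)` lies in `𝔪^(r+1) = x𝔪^r`, so `x` divides it. -/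
theorem mem_nonZeroDivisors_of_pow_succ_eq
    (hr : maximalIdeal A ^ (r + 1) = Ideal.span {x} * maximalIdeal A ^ r)
    {y : A} (hy : y ∈ maximalIdeal A) (hy' : y ∈ nonZeroDivisors A) : x ∈ nonZeroDivisors A := by
  have h := Ideal.pow_mem_pow hy (r + 1)
  rw [hr, Ideal.mem_span_singleton_mul] at h
  obtain ⟨c, -, hc⟩ := h
  exact (mul_mem_nonZeroDivisors.1 (hc ▸ pow_mem hy' (r + 1))).1

/-- The ideal `(𝔪ⁿ : xᵏ)`. -/
noncomputable def powColon (x : A) (n k : ℕ) : Ideal A :=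
  Submodule.comap (LinearMap.mulLeft A (x ^ k)) (maximalIdeal A ^ n)

theorem mem_powColon {n k : ℕ} {a : A} : a ∈ powColon x n k ↔ x ^ k * a ∈ maximalIdeal A ^ n :=
  Iff.rfl

theorem powColon_zero (n : ℕ) : powColon x n 0 = maximalIdeal A ^ n := by
  ext a
  rw [mem_powColon, pow_zero, one_mul]

omit [IsLocalRing A] in
theorem map_mulLeft_eq (k : ℕ) (I : Ideal A) :
    Submodule.map (LinearMap.mulLeft A (x ^ k)) I = Ideal.span {x ^ k} * I := by
  ext a
  rw [Ideal.mem_span_singleton_mul]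
  rfl

theorem pow_mul_mem (hx : Ideal.span {x} ≤ maximalIdeal A) {n : ℕ} {a : A}
    (ha : a ∈ maximalIdeal A ^ n) (k : ℕ) : x ^ k * a ∈ maximalIdeal A ^ (n + k) := by
  rw [add_comm, pow_add]
  exact Ideal.mul_mem_mul (Ideal.pow_mem_pow (hx (Ideal.mem_span_singleton_self x)) k) ha

theorem pow_mul_mem_iff (hx : Ideal.span {x} ≤ maximalIdeal A) (hreg : x ∈ nonZeroDivisors A)
    (hr : maximalIdeal A ^ (r + 1) = Ideal.span {x} * maximalIdeal A ^ r) {n : ℕ} (hn : r ≤ n)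
    (k : ℕ) {a : A} : x ^ k * a ∈ maximalIdeal A ^ (n + k) ↔ a ∈ maximalIdeal A ^ n := by
  refine ⟨fun h => ?_, fun h => pow_mul_mem hx h k⟩
  rw [pow_add_eq_of_pow_succ_eq hr hn, Ideal.mem_span_singleton_mul] at h
  obtain ⟨b, hb, h⟩ := h
  exact (mul_cancel_left_mem_nonZeroDivisors (pow_mem hreg k)).1 h ▸ hb

/-- From exponent `r` on, multiplication by `x` shifts the powers of `𝔪` exactly, so both exponents
of the colon may be raised together. -/
theorem powColon_add (hx : Ideal.span {x} ≤ maximalIdeal A) (hreg : x ∈ nonZeroDivisors A)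
    (hr : maximalIdeal A ^ (r + 1) = Ideal.span {x} * maximalIdeal A ^ r) {n : ℕ} (hn : r ≤ n)
    (j k : ℕ) : powColon x (n + k) (j + k) = powColon x n j := by
  ext a
  rw [mem_powColon, mem_powColon, add_comm j k, pow_add x, mul_assoc, pow_mul_mem_iff hx hreg hr hn]

omit [IsLocalRing A] in
theorem mulLeft_pow_injective (hreg : x ∈ nonZeroDivisors A) (k : ℕ) :
    Function.Injective (LinearMap.mulLeft A (x ^ k)) := fun _ _ h =>
  (mul_cancel_left_mem_nonZeroDivisors (pow_mem hreg k)).1 h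

/-- Raising both exponents by one covers the exponent `-1`, needed for `g_r`, by a natural exponent.
-/
theorem colonPow_eq_powColon (hx : Ideal.span {x} ≤ maximalIdeal A) (hreg : x ∈ nonZeroDivisors A)
    (hr : maximalIdeal A ^ (r + 1) = Ideal.span {x} * maximalIdeal A ^ r) {i : ℕ}
    (hi : i ≤ r + 1) : colonPow x r ((r : ℤ) - i) = powColon x (r + 1) (r + 1 - i) := by
  rw [colonPow]
  split_ifs with h
  · rw [show r + 1 - i = r - i + 1 by omega, powColon_add hx hreg hr le_rfl]
    ext a
    rw [Submodule.mem_colon_singleton, mem_powColon, smul_eq_mul, mul_comm,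
      show ((r : ℤ) - i).toNat = r - i by omega]
  -- Here `i = r + 1`, and both sides are `x𝔪^r = 𝔪^(r+1)`.
  · rw [show (-((r : ℤ) - i)).toNat = 1 by omega, show r + 1 - i = 0 by omega, powColon_zero,
      pow_add_eq_of_pow_succ_eq hr le_rfl]

/-! The tangent cone -/

/-- The classes `a Tⁿ`, as a semilinear map to the component of degree `n`. -/
noncomputable def FiberCone.homLinear (I : Ideal A) (n : ℕ) :
    ↥(I ^ n) →ₛₗ[residue A] ↥(FiberCone.piece I n) where
  toFun a := ⟨FiberCone.hom I n a, FiberCone.hom_mem_piece I n a⟩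
  map_add' a b := Subtype.ext (FiberCone.hom_add I n a b)
  map_smul' c a := Subtype.ext (FiberCone.hom_smul I n c a)

theorem FiberCone.homLinear_surjective (I : Ideal A) (n : ℕ) :
    Function.Surjective (FiberCone.homLinear I n) := by
  rintro ⟨z, hz⟩
  obtain ⟨a, rfl⟩ := (FiberCone.mem_component_iff I n z).1 hz
  exact ⟨a, rfl⟩

theorem finite_piece [IsNoetherianRing A] (I : Ideal A) (n : ℕ) :
    Module.Finite (ResidueField A) (FiberCone.piece I n) := by
  have : RingHomSurjective (residue A) := ⟨residue_surjective⟩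
  exact Module.Finite.of_surjective (FiberCone.homLinear I n) (FiberCone.homLinear_surjective I n)

theorem FiberCone.hom_maximalIdeal_eq_zero_iff (n : ℕ) (a : ↥(maximalIdeal A ^ n)) :
    FiberCone.hom (maximalIdeal A) n a = 0 ↔ (a : A) ∈ maximalIdeal A ^ (n + 1) := by
  rw [hom_eq_zero_iff, ← pow_succ']

/-- The class of `a` in degree `i` is killed by the `(n-i)`-th power of `x*` exactly when `x^(n-i) a
∈ 𝔪^(n+1)`. -/
theorem quotLength_powColon_eq_length (hx : Ideal.span {x} ≤ maximalIdeal A) {i n : ℕ}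
    (hin : i ≤ n) :
    quotLength (maximalIdeal A ^ i) (powColon x (n + 1) (n - i)) =
      Module.length (ResidueField A)
        ((FiberCone.piece (maximalIdeal A) i).map (xStarMul hx ^ (n - i))) := by
  refine quotLength_eq_of_semilinear _ _
    (((xStarMul hx ^ (n - i)).submoduleMap (FiberCone.piece (maximalIdeal A) i)).comp
      (FiberCone.homLinear (maximalIdeal A) i))
    ((LinearMap.submoduleMap_surjective _ _).comp (FiberCone.homLinear_surjective _ _)) ?_
  intro a
  have h := xStarMul_pow_hom hx (n - i) i a (pow_mul_mem hx a.2 _)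
  rw [← Subtype.coe_inj]
  change (xStarMul hx ^ (n - i)) (FiberCone.hom _ i a) = 0 ↔ _
  rw [h, FiberCone.hom_maximalIdeal_eq_zero_iff, mem_powColon]
  simp only [Nat.add_sub_cancel' hin]

theorem quotLength_powColon_eq_card [IsNoetherianRing A] (hx : Ideal.span {x} ≤ maximalIdeal A)
    {ι : Type*} [Fintype ι] {deg : ι → ℕ} {death : ι → ℕ∞} {y : ι → FiberCone (maximalIdeal A)}
    (h : IsHomogBasis (xStarMul hx) (FiberCone.piece (maximalIdeal A)) deg death y)
    {i n : ℕ} (hin : i ≤ n) :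
    quotLength (maximalIdeal A ^ i) (powColon x (n + 1) (n - i)) =
      ((Finset.univ.filter fun s => deg s ≤ i ∧ (n : ℕ∞) < death s).card : ℕ∞) := by
  have := finite_piece (maximalIdeal A) i
  rw [quotLength_powColon_eq_length hx hin, ← h.finrank_map (xStarMul_mem hx) hin,
    Module.length_eq_finrank]

theorem exists_isTangentConeInvariants [IsNoetherianRing A]
    (hx : Ideal.span {x} ≤ maximalIdeal A) (hreg : x ∈ nonZeroDivisors A)
    (hr : maximalIdeal A ^ (r + 1) = Ideal.span {x} * maximalIdeal A ^ r) :
    ∃ (α : ℕ → ℕ) (τ : ℕ → ℕ → ℕ) (y : _), IsHomogBasis (xStarMul hx)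
      (FiberCone.piece (maximalIdeal A)) (indexDeg r α τ) (indexDeath r α τ) y := by
  have hfin := finite_piece (maximalIdeal A)
  refine exists_isHomogBasis _ _ r (xStarMul_mem hx) ?_ ?_ ?_
  · intro n hn z hz
    obtain ⟨⟨a, ha⟩, rfl⟩ := (FiberCone.mem_component_iff _ _ z).1 hz
    have ha' := ha
    rw [pow_add_eq_of_pow_succ_eq hr hn, Ideal.mem_span_singleton_mul] at ha'
    obtain ⟨b, hb, rfl⟩ := ha'
    refine ⟨FiberCone.hom _ n ⟨b, hb⟩, FiberCone.hom_mem_piece _ _ _, ?_⟩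
    have := xStarMul_pow_hom hx 1 n ⟨b, hb⟩ ha
    rwa [pow_one] at this
  · intro n hn z hz h
    obtain ⟨a, rfl⟩ := (FiberCone.mem_component_iff _ _ z).1 hz
    rw [← pow_one (xStarMul hx), xStarMul_pow_hom hx 1 n a (pow_mul_mem hx a.2 1),
      FiberCone.hom_maximalIdeal_eq_zero_iff, add_right_comm,
      pow_mul_mem_iff hx hreg hr (by omega)] at h
    exact (FiberCone.hom_maximalIdeal_eq_zero_iff _ _).2 h
  -- Torsion in degree `0` would give `x^n ∈ 𝔪^(n+1)`. Then `𝔪^(r+n) = x^n𝔪^r` lies in `𝔪·𝔪^(r+n)`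
  -- and vanishes by Nakayama, although it contains the regular element `x^(r+n)`.
  · intro n z hz h
    obtain ⟨a, rfl⟩ := (FiberCone.mem_component_iff _ _ z).1 hz
    rw [xStarMul_pow_hom hx n 0 a (pow_mul_mem hx a.2 n),
      FiberCone.hom_maximalIdeal_eq_zero_iff] at h
    rw [FiberCone.hom_maximalIdeal_eq_zero_iff, zero_add, pow_one]
    by_contra ha
    have hu : IsUnit (a : A) := by simpa [mem_maximalIdeal] using ha
    have hxn : x ^ n ∈ maximalIdeal A ^ (n + 1) := by
      simp only [zero_add] at h
      exact ((Ideal.unit_mul_mem_iff_mem _ hu).1 (mul_comm (x ^ n) (a : A) ▸ h))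
    have hle : maximalIdeal A ^ (r + n) ≤ maximalIdeal A * maximalIdeal A ^ (r + n) := by
      conv_lhs => rw [pow_add_eq_of_pow_succ_eq hr le_rfl]
      rw [← pow_succ', show r + n + 1 = (n + 1) + r by omega, pow_add _ (n + 1)]
      exact Ideal.mul_mono_left ((Ideal.span_singleton_le_iff_mem _).2 hxn)
    have hbot := Submodule.eq_bot_of_le_smul_of_le_jacobson_bot (maximalIdeal A) _
      (IsNoetherian.noetherian (maximalIdeal A ^ (r + n))) hle (maximalIdeal_le_jacobson _)
    have : x ^ (r + n) ∈ maximalIdeal A ^ (r + n) :=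
      Ideal.pow_mem_pow (hx (Ideal.mem_span_singleton_self x)) _
    rw [hbot, Ideal.mem_bot] at this
    exact zero_notMem_nonZeroDivisors (this ▸ pow_mem hreg (r + n))

/-! Apery invariants -/

/-- Lengths along `𝔪^(i+1) ≤ x𝔪^(i-1) + 𝔪^(i+1) ≤ 𝔪^i ∩ xA + 𝔪^(i+1) ≤ 𝔪^i`. The top step is `γ_i`,
the middle one `ν_i`, and the bottom one is the image of `x*` from degree `i-1`. -/
theorem aperyInvariant_add_nu (hx : Ideal.span {x} ≤ maximalIdeal A) {i : ℕ} (hi : 1 ≤ i) :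
    aperyInvariant x i + nu x i +
        quotLength (maximalIdeal A ^ (i - 1)) (powColon x (i + 1) (i - (i - 1))) =
      quotLength (maximalIdeal A ^ i) (powColon x (i + 1) (i - i)) := by
  have hle : maximalIdeal A ^ (i + 1) ≤ maximalIdeal A ^ i := Ideal.pow_le_pow_right (by omega)
  have hle' : Ideal.span {x} * maximalIdeal A ^ (i - 1) ≤ maximalIdeal A ^ i := by
    conv_rhs => rw [show i = (i - 1) + 1 by omega, pow_succ']
    exact Ideal.mul_mono_left hx
  rw [Nat.sub_self, powColon_zero, show i - (i - 1) = 1 by omega, powColon, ← quotLength_map,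
    map_mulLeft_eq, pow_one, ← quotLength_sup, aperyInvariant, quotLength_sup_sup _ hle, nu,
    ← quotLength_add, ← quotLength_add le_sup_right]
  · exact sup_le hle' hle
  · exact sup_le_sup_right (le_inf hle' Ideal.mul_le_left) _
  · exact sup_le inf_le_left hle

/-- Insert `𝔪^i + (𝔪^r : x^(r-i-1))` between the two colon ideals: `g_i` is the upper step, and the
lower one is a rank on the tangent cone. -/
theorem quotLength_powColon_powColon (hx : Ideal.span {x} ≤ maximalIdeal A)
    (hreg : x ∈ nonZeroDivisors A)
    (hr : maximalIdeal A ^ (r + 1) = Ideal.span {x} * maximalIdeal A ^ r)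
    (hr' : reductionNumber (Ideal.span {x}) (maximalIdeal A) = r) {i : ℕ} (hi : i ≤ r) :
    quotLength (powColon x (r + 1) (r + 1 - i)) (powColon x (r + 1) (r + 1 - (i + 1))) =
      gLength x i + quotLength (maximalIdeal A ^ i) (powColon x (r + 1) (r - i)) := by
  have h : colonPow x r ((r : ℤ) - i - 1) = powColon x (r + 1) (r + 1 - (i + 1)) := by
    rw [← colonPow_eq_powColon hx hreg hr (by omega)]
    push_cast
    rw [sub_sub]
  simp only [gLength, hr', h, colonPow_eq_powColon hx hreg hr (show i ≤ r + 1 by omega)]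
  rw [show r - i = r + 1 - (i + 1) by omega, ← quotLength_sup (maximalIdeal A ^ i),
    ← quotLength_add le_sup_right]
  refine sup_le (fun a ha => ?_) fun a ha => ?_
  · have := pow_mul_mem hx ha (r + 1 - i)
    rwa [Nat.add_sub_cancel' (by omega), ← mem_powColon] at this
  · rw [mem_powColon] at ha ⊢
    rw [show r + 1 - i = r + 1 - (i + 1) + 1 by omega, pow_succ' x, mul_assoc]
    exact Ideal.mul_mem_left _ _ ha

/-! The first neighborhood ring -/

/-- All fractions have the common denominator `x^r`. For large `N`, `b x^(N+r)` lies in `𝔪^(N+r+s) =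
a𝔪^(N+r) = a x^N 𝔪^r`, and cancelling `a x^N` leaves `b/a = d/x^r`. -/
theorem mem_firstNeighborhood_iff (hx : Ideal.span {x} ≤ maximalIdeal A)
    (hreg : x ∈ nonZeroDivisors A)
    (hr : maximalIdeal A ^ (r + 1) = Ideal.span {x} * maximalIdeal A ^ r) (z : FractionRing A) :
    z ∈ firstNeighborhood A ↔
      ∃ d ∈ maximalIdeal A ^ r, algebraMap A (FractionRing A) d = algebraMap A _ (x ^ r) * z := by
  have hxm := hx (Ideal.mem_span_singleton_self x)
  constructor
  · rintro ⟨s, a, b, ⟨ha, N, hN⟩, har, hb, h⟩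
    have h1 : b * x ^ (N + r) ∈ maximalIdeal A ^ (N + r + s) := by
      rw [add_comm, pow_add]
      exact Ideal.mul_mem_mul hb (Ideal.pow_mem_pow hxm _)
    rw [hN _ (by omega), Ideal.mem_span_singleton_mul] at h1
    obtain ⟨c, hc, hcb⟩ := h1
    rw [add_comm N r, pow_add_eq_of_pow_succ_eq hr le_rfl, Ideal.mem_span_singleton_mul] at hc
    obtain ⟨d, hd, rfl⟩ := hc
    refine ⟨d, hd, ?_⟩
    have hu := IsLocalization.map_units (FractionRing A)
      (⟨a * x ^ N, mul_mem har (pow_mem hreg N)⟩ : nonZeroDivisors A)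
    refine hu.mul_left_cancel ?_
    have := congrArg (algebraMap A (FractionRing A)) hcb
    simp only [map_mul, map_pow, ← h] at this ⊢
    rw [pow_add] at this
    linear_combination this
  · rintro ⟨d, hd, h⟩
    exact ⟨r, x ^ r, d, ⟨Ideal.pow_mem_pow hxm r, r, fun n hn =>
      pow_add_eq_of_pow_succ_eq hr hn r⟩, pow_mem hreg r, hd, by rw [h, mul_comm]⟩

theorem map_firstNeighborhood (hx : Ideal.span {x} ≤ maximalIdeal A)
    (hreg : x ∈ nonZeroDivisors A)
    (hr : maximalIdeal A ^ (r + 1) = Ideal.span {x} * maximalIdeal A ^ r) (i : ℕ) :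
    (maximalIdeal A ^ i • (firstNeighborhood A).toSubmodule).map
        (LinearMap.mulLeft A (algebraMap A (FractionRing A) (x ^ r))) =
      Submodule.map (Algebra.linearMap A (FractionRing A)) (maximalIdeal A ^ (r + i)) := by
  have h0 : (firstNeighborhood A).toSubmodule.map
        (LinearMap.mulLeft A (algebraMap A (FractionRing A) (x ^ r))) =
      Submodule.map (Algebra.linearMap A (FractionRing A)) (maximalIdeal A ^ r) := by
    ext z
    constructor
    · rintro ⟨w, hw, rfl⟩
      exact (mem_firstNeighborhood_iff hx hreg hr w).1 hw
    · rintro ⟨d, hd, rfl⟩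
      obtain ⟨w, hw⟩ := IsLocalization.map_units (FractionRing A)
        (⟨x ^ r, pow_mem hreg r⟩ : nonZeroDivisors A) |>.exists_right_inv
      have hw' : algebraMap A (FractionRing A) (x ^ r) * (w * algebraMap A _ d) =
          algebraMap A _ d := by
        rw [← mul_assoc, hw, one_mul]
      exact ⟨w * algebraMap A _ d, (mem_firstNeighborhood_iff hx hreg hr _).2 ⟨d, hd, hw'.symm⟩,
        hw'⟩
  rw [Submodule.map_smul'', h0, ← Submodule.map_smul'', smul_eq_mul, add_comm, pow_add]

/-- Apply `quotLength_sup_sup_add` to the inclusion of `A` in its ring of fractions. Multiplication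
by `x^r` turns `𝔪^iA'` into `𝔪^(r+i)`, so the successive quotients all have the length of
`𝔪^r/𝔪^(r+1)`, and `𝔪^jA' ∩ A = (𝔪^(r+j) : x^r)`. -/
theorem microLength_add (hx : Ideal.span {x} ≤ maximalIdeal A)
    (hreg : x ∈ nonZeroDivisors A)
    (hr : maximalIdeal A ^ (r + 1) = Ideal.span {x} * maximalIdeal A ^ r) {i : ℕ} (hi : i ≤ r) :
    microLength A i +
        quotLength (powColon x (r + 1) (r + 1 - i)) (powColon x (r + 1) (r + 1 - (i + 1))) =
      quotLength (maximalIdeal A ^ r) (maximalIdeal A ^ (r + 1)) := by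
  have hinj : Function.Injective (Algebra.linearMap A (FractionRing A)) :=
    IsFractionRing.injective A (FractionRing A)
  have hinj' : Function.Injective
      (LinearMap.mulLeft A (algebraMap A (FractionRing A) (x ^ r))) := fun z w h =>
    (IsLocalization.map_units (FractionRing A)
      (⟨x ^ r, pow_mem hreg r⟩ : nonZeroDivisors A)).mul_left_cancel h
  have hcomap : ∀ j ≤ r + 1, (maximalIdeal A ^ j • (firstNeighborhood A).toSubmodule).comap
      (Algebra.linearMap A (FractionRing A)) = powColon x (r + 1) (r + 1 - j) := by
    intro j hj
    ext a
    rw [Submodule.mem_comap, ← mem_map_iff_of_injective hinj',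
      map_firstNeighborhood hx hreg hr, LinearMap.mulLeft_apply, Algebra.linearMap_apply,
      ← map_mul, ← Algebra.linearMap_apply, mem_map_iff_of_injective hinj,
      ← mem_powColon, ← powColon_add hx hreg hr (show r ≤ r + j by omega) r 1,
      ← powColon_add hx hreg hr (show r ≤ r + 1 by omega) (r + 1 - j) j, add_right_comm, Nat.sub_add_cancel hj]
  have hle : maximalIdeal A ^ (i + 1) • (firstNeighborhood A).toSubmodule ≤
      maximalIdeal A ^ i • (firstNeighborhood A).toSubmodule :=
    Submodule.smul_mono_left (Ideal.pow_le_pow_right (by omega))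
  have hbot : (⊥ : Subalgebra A (FractionRing A)).toSubmodule =
      LinearMap.range (Algebra.linearMap A (FractionRing A)) := by
    ext z
    simp [Algebra.mem_bot]
  rw [microLength, addPowNeighborhood, addPowNeighborhood, hbot, ← hcomap i (by omega),
    ← hcomap (i + 1) (by omega), quotLength_sup_sup_add _ hle, ← quotLength_map_map hinj',
    map_firstNeighborhood hx hreg hr, map_firstNeighborhood hx hreg hr, quotLength_map_map hinj,
    pow_add_eq_of_pow_succ_eq hr le_rfl, ← add_assoc, add_right_comm,
    pow_add_eq_of_pow_succ_eq hr (Nat.le_succ r), ← map_mulLeft_eq, ← map_mulLeft_eq,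
    quotLength_map_map (mulLeft_pow_injective hreg i)]

end Reduction

/-! ### Counting the summands by degree and death. -/

section Count

variable {r : ℕ} {α : ℕ → ℕ} {τ : ℕ → ℕ → ℕ}

theorem card_indexDeg_eq {i : ℕ} (n : ℕ) (hi : i ∈ Finset.Icc 1 r) :
    (Finset.univ.filter fun s => indexDeg r α τ s = i ∧ (n : ℕ∞) < indexDeath r α τ s).card =
      α i + ∑ j ∈ Finset.Icc 1 (r - i), if n < i + j then τ i j else 0 := by
  rw [Finset.mem_Icc] at hi
  rw [Finset.card_filter, Fintype.sum_sum_type]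
  congr 1
  · have h1 : ∀ s : FreeIndex r α, (if indexDeg r α τ (Sum.inl s) = i ∧
        (n : ℕ∞) < indexDeath r α τ (Sum.inl s) then 1 else 0) = if s.1.1 = i then 1 else 0 :=
      fun s => by simp [indexDeg, indexDeath]
    simp_rw [h1]
    refine ((Fintype.sum_sigma _).trans (Finset.sum_congr rfl fun p _ =>
      Fin.sum_const (α p.1) (if p.1 = i then 1 else 0))).trans ?_
    simp only [smul_eq_mul, mul_ite, mul_one, mul_zero]
    rw [Finset.sum_coe_sort (Finset.Icc 0 r) (fun i' => if i' = i then α i' else 0),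
      Finset.sum_ite_eq', if_pos (by simp; omega)]
  · have h1 : ∀ t : TorsionIndex r τ, (if indexDeg r α τ (Sum.inr t) = i ∧
        (n : ℕ∞) < indexDeath r α τ (Sum.inr t) then 1 else 0) =
        if t.1.1.1 = i ∧ n < t.1.1.1 + t.1.1.2 then 1 else 0 :=
      fun t => by simp only [indexDeg, indexDeath, Sum.elim_inr, Nat.cast_lt]
    simp_rw [h1]
    refine ((Fintype.sum_sigma _).trans (Finset.sum_congr rfl fun p _ =>
      Fin.sum_const (τ p.1.1 p.1.2) (if p.1.1 = i ∧ n < p.1.1 + p.1.2 then 1 else 0))).trans ?_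
    simp only [smul_eq_mul, mul_ite, mul_one, mul_zero]
    rw [Finset.sum_coe_sort ((Finset.Icc 1 (r - 1)).sigma fun i => Finset.Icc 1 (r - i))
      (fun p => if p.1 = i ∧ n < p.1 + p.2 then τ p.1 p.2 else 0), Finset.sum_sigma,
      Finset.sum_eq_single i]
    · simp
    · intro b _ hb
      simp [hb]
    -- For `i = r` the outer range omits `i`, but the range of `j` is then empty.
    · intro h
      have : r - i = 0 := by
        simp at h
        omega
      simp [this]

theorem card_indexDeg_le {i : ℕ} (n : ℕ) (hi : i ∈ Finset.Icc 1 r) :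
    (Finset.univ.filter fun s => indexDeg r α τ s ≤ i ∧ (n : ℕ∞) < indexDeath r α τ s).card =
      (Finset.univ.filter fun s =>
        indexDeg r α τ s ≤ i - 1 ∧ (n : ℕ∞) < indexDeath r α τ s).card +
      (α i + ∑ j ∈ Finset.Icc 1 (r - i), if n < i + j then τ i j else 0) := by
  rw [← card_indexDeg_eq n hi, ← Finset.card_union_of_disjoint]
  · rw [Finset.mem_Icc] at hi
    congr 1
    ext s
    simp only [Finset.mem_filter_univ, Finset.mem_union]
    rw [← or_and_right]
    exact and_congr_left fun _ => by omega
  · rw [Finset.disjoint_filter]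
    rintro s - ⟨h1, -⟩ ⟨h2, -⟩
    rw [Finset.mem_Icc] at hi
    omega

/-- The hypothesis says that nothing generated in degrees at most `r-1` dies exactly at degree `r`,
which is what a summand with `j = r-i` would do. -/
theorem torsion_eq_zero_of_card_eq
    (h : (Finset.univ.filter fun s =>
        indexDeg r α τ s ≤ r - 1 ∧ ((r - 1 : ℕ) : ℕ∞) < indexDeath r α τ s).card =
      (Finset.univ.filter fun s =>
        indexDeg r α τ s ≤ r - 1 ∧ (r : ℕ∞) < indexDeath r α τ s).card)
    {i : ℕ} (hi : i ∈ Finset.Icc 1 (r - 1)) : τ i (r - i) = 0 := by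
  by_contra h0
  have hi' := Finset.mem_Icc.1 hi
  let t : TorsionIndex r τ := ⟨⟨⟨i, r - i⟩, by simp; omega⟩, ⟨0, Nat.pos_of_ne_zero h0⟩⟩
  have hdeg : indexDeg r α τ (Sum.inr t) = i := rfl
  have hdeath : indexDeath r α τ (Sum.inr t) = (r : ℕ∞) := by
    change ((i + (r - i) : ℕ) : ℕ∞) = r
    rw [Nat.add_sub_cancel' (by omega)]
  have heq := Finset.eq_of_subset_of_card_le (fun s hs => ?_) h.le
  · have ht : Sum.inr t ∈ Finset.univ.filter fun s =>
        indexDeg r α τ s ≤ r - 1 ∧ ((r - 1 : ℕ) : ℕ∞) < indexDeath r α τ s := by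
      rw [Finset.mem_filter_univ, hdeg, hdeath, Nat.cast_lt]
      omega
    rw [← heq, Finset.mem_filter_univ, hdeath] at ht
    exact lt_irrefl _ ht.2
  · rw [Finset.mem_filter_univ] at hs ⊢
    exact ⟨hs.1, lt_of_le_of_lt (Nat.cast_le.2 (Nat.sub_le r 1)) hs.2⟩

end Count

/-! ### The relation between the invariants. -/

section Relation

variable [IsNoetherianRing A] {x : A} {r : ℕ}

theorem microInvariant_add_sum (hx : Ideal.span {x} ≤ maximalIdeal A) (hreg : x ∈ nonZeroDivisors A)
    (hr : maximalIdeal A ^ (r + 1) = Ideal.span {x} * maximalIdeal A ^ r)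
    (hr' : reductionNumber (Ideal.span {x}) (maximalIdeal A) = r) {α : ℕ → ℕ} {τ : ℕ → ℕ → ℕ}
    {y : FreeIndex r α ⊕ TorsionIndex r τ → FiberCone (maximalIdeal A)}
    (h : IsHomogBasis (xStarMul hx) (FiberCone.piece (maximalIdeal A)) (indexDeg r α τ)
      (indexDeath r α τ) y) {i : ℕ} (hi : i ∈ Finset.Icc 1 r) :
    (microLength A (i - 1) ≠ ⊤ ∧ microLength A i ≠ ⊤ ∧ aperyInvariant x i ≠ ⊤ ∧ nu x i ≠ ⊤ ∧
      gLength x i ≠ ⊤ ∧ gLength x (i - 1) ≠ ⊤) ∧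
    microInvariant A i + ∑ j ∈ Finset.Icc 1 (r - i - 1), (τ i j : ℤ) =
      ((aperyInvariant x i).toNat : ℤ) + ((nu x i).toNat : ℤ) + ((gLength x i).toNat : ℤ) -
        ((gLength x (i - 1)).toNat : ℤ) := by
  have hi' := Finset.mem_Icc.1 hi
  have hcard := fun {i n : ℕ} (hin : i ≤ n) => quotLength_powColon_eq_card hx h hin
  have hcard' := hcard (le_refl r)
  rw [Nat.sub_self, powColon_zero] at hcard'
  have hmicro : ∀ i ≤ r, microLength A i + (gLength x i +
      ((Finset.univ.filter fun s =>
        indexDeg r α τ s ≤ i ∧ (r : ℕ∞) < indexDeath r α τ s).card : ℕ∞)) =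
      ((Finset.univ.filter fun s =>
        indexDeg r α τ s ≤ r ∧ (r : ℕ∞) < indexDeath r α τ s).card : ℕ∞) := fun i hi => by
    rw [← hcard hi, ← quotLength_powColon_powColon hx hreg hr hr' hi, microLength_add hx hreg hr hi,
      hcard']
  have h1 := hmicro i hi'.2
  have h2 := hmicro (i - 1) (by omega)
  have h3 := aperyInvariant_add_nu hx hi'.1
  rw [hcard (Nat.sub_le i 1), hcard le_rfl, card_indexDeg_le i hi] at h3
  rw [card_indexDeg_le r hi] at h1
  -- All torsion generated in degree `i` is dead in degree `r`, so the micro-invariants see only `α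
  -- i`.
  have h4 : ∑ j ∈ Finset.Icc 1 (r - i), (if r < i + j then τ i j else 0) = 0 :=
    Finset.sum_eq_zero fun j hj => if_neg (by have := Finset.mem_Icc.1 hj; omega)
  have h5 : ∑ j ∈ Finset.Icc 1 (r - i), (if i < i + j then τ i j else 0) =
      ∑ j ∈ Finset.Icc 1 (r - i - 1), τ i j := by
    rcases hi'.2.eq_or_lt with rfl | hlt
    · simp
    have hτ : τ i (r - i) = 0 := by
      refine torsion_eq_zero_of_card_eq (α := α) ?_ (Finset.mem_Icc.2 ⟨hi'.1, by omega⟩)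
      -- Regularity of `x` and `𝔪^(r+1) = x𝔪^r` give `(𝔪^(r+1) : x) = 𝔪^r`, so `x*` is injective in
      -- degree `r-1` and the two counts coincide.
      have h6 := hcard (le_refl (r - 1))
      rw [Nat.sub_self, show r - 1 + 1 = r by omega, ← powColon_add hx hreg hr le_rfl 0 1,
        show 0 + 1 = r - (r - 1) by omega, hcard (Nat.sub_le r 1)] at h6
      exact_mod_cast h6.symm
    rw [← Finset.insert_Icc_sub_one_right_eq_Icc (show 1 ≤ r - i by omega), Finset.sum_insert (by simp; omega), hτ, ite_self, zero_add]
    exact Finset.sum_congr rfl fun j hj => if_pos (by have := Finset.mem_Icc.1 hj; omega)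
  rw [h4] at h1
  rw [h5] at h3
  -- Finiteness: each length is a summand in an identity whose total is a number of generators.
  have hne : ∀ {a b : ℕ∞} {n : ℕ}, a + b = n → ∃ k l : ℕ, a = k ∧ b = l := by
    intro a b n hab
    have hab' : a + b ≠ ⊤ := hab ▸ ENat.natCast_ne_top n
    rw [Ne, ENat.add_eq_top, not_or] at hab'
    obtain ⟨k, hk⟩ := ENat.ne_top_iff_exists.1 hab'.1
    obtain ⟨l, hl⟩ := ENat.ne_top_iff_exists.1 hab'.2
    exact ⟨k, l, hk.symm, hl.symm⟩
  obtain ⟨m₁, p₁, hm₁, hp₁⟩ := hne h1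
  obtain ⟨g₁, -, hg₁, -⟩ := hne hp₁
  obtain ⟨m₂, p₂, hm₂, hp₂⟩ := hne h2
  obtain ⟨g₂, -, hg₂, -⟩ := hne hp₂
  obtain ⟨p₃, -, hp₃, -⟩ := hne h3
  obtain ⟨γ, ν, hγ, hν⟩ := hne hp₃
  rw [hm₁, hg₁] at h1
  rw [hm₂, hg₂] at h2
  rw [hγ, hν] at h3
  simp only [microInvariant, hm₁, hm₂, hg₁, hg₂, hγ, hν, ENat.toNat_natCast]
  refine ⟨⟨ENat.natCast_ne_top _, ENat.natCast_ne_top _, ENat.natCast_ne_top _,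
    ENat.natCast_ne_top _, ENat.natCast_ne_top _, ENat.natCast_ne_top _⟩, ?_⟩
  norm_cast at h1 h2 h3
  rw [← Nat.cast_sum]
  omega

end Relation

end TangentCone

theorem mainTheorem7 {A : Type*} [CommRing A] [IsLocalRing A]
    (hCM : TangentCone.IsCohenMacaulayLocal A) (hdim : ringKrullDim A = 1)
    (hres : Infinite (IsLocalRing.ResidueField A))
    (x : A)
    (hx : TangentCone.IsMinimalReduction (Ideal.span {x}) (IsLocalRing.maximalIdeal A)) :
    -- the invariants of the tangent cone exist
    (∃ (α : ℕ → ℕ) (τ : ℕ → ℕ → ℕ), TangentCone.IsTangentConeInvariants x hx.prop.1 α τ) ∧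
    ∀ i ∈ Finset.Icc 1
        (TangentCone.reductionNumber (Ideal.span {x}) (IsLocalRing.maximalIdeal A)),
      -- all the lengths involved are finite
      (TangentCone.microLength A (i - 1) ≠ ⊤ ∧ TangentCone.microLength A i ≠ ⊤ ∧
        TangentCone.aperyInvariant x i ≠ ⊤ ∧ TangentCone.nu x i ≠ ⊤ ∧
        TangentCone.gLength x i ≠ ⊤ ∧ TangentCone.gLength x (i - 1) ≠ ⊤) ∧
      -- the relation, for the invariants given by any decomposition of the tangent cone
      ∀ (α : ℕ → ℕ) (τ : ℕ → ℕ → ℕ), TangentCone.IsTangentConeInvariants x hx.prop.1 α τ →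
        TangentCone.microInvariant A i +
            ∑ j ∈ Finset.Icc 1
              (TangentCone.reductionNumber (Ideal.span {x}) (IsLocalRing.maximalIdeal A) - i - 1),
              (τ i j : ℤ) =
          ((TangentCone.aperyInvariant x i).toNat : ℤ) + ((TangentCone.nu x i).toNat : ℤ) +
            ((TangentCone.gLength x i).toNat : ℤ) -
            ((TangentCone.gLength x (i - 1)).toNat : ℤ) := by
  have hnoeth : IsNoetherianRing A := hCM.1
  have hr : IsLocalRing.maximalIdeal A ^
      (TangentCone.reductionNumber (Ideal.span {x}) (IsLocalRing.maximalIdeal A) + 1) =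
      Ideal.span {x} * IsLocalRing.maximalIdeal A ^
        TangentCone.reductionNumber (Ideal.span {x}) (IsLocalRing.maximalIdeal A) :=
    Nat.sInf_mem hx.prop.2
  obtain ⟨y, hy, hy'⟩ :=
    TangentCone.exists_mem_nonZeroDivisors_of_isCohenMacaulayLocal hCM hdim
  have hreg := TangentCone.mem_nonZeroDivisors_of_pow_succ_eq hr hy hy'
  obtain ⟨α₀, τ₀, y₀, h₀⟩ := TangentCone.exists_isTangentConeInvariants hx.prop.1 hreg hr
  refine ⟨⟨α₀, τ₀, TangentCone.exists_equiv_of_isHomogBasis hx.prop.1 hreg h₀⟩, fun i hi => ⟨?_, ?_⟩⟩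
  · exact (TangentCone.microInvariant_add_sum hx.prop.1 hreg hr rfl h₀ hi).1
  · rintro α τ ⟨e, he, hgr⟩
    obtain ⟨y, h⟩ := TangentCone.exists_isHomogBasis_of_equiv hx.prop.1 hreg e he hgr
    exact (TangentCone.microInvariant_add_sum hx.prop.1 hreg hr rfl h hi).2
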